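/- Let $\mathcal V$ be an arbitrary set (finite, infinite or empty), whose elements $x,y,z,u,\dots$ are called variables. Formulae are built from the atomic formulae $\top$ and $x\equiv y$ ($x,y\in\mathcal V$) by the binary connective $\wedge$. Arrow terms $f:A\vdash B$ between formulae are generated from the primitive arrow terms (for all formulae $A,B,C$ and all variables $x,y,z$) $$\mathbf 1_A:A\vdash A,\qquad b^{\to}_{A,B,C}:A\wedge(B\wedge C)\vdash(A\wedge B)\wedge C,\qquad b^{\leftarrow}_{A,B,C}:(A\wedge B)\wedge C\vdash A\wedge(B\wedge C),$$ $$\delta^{\to}_A:A\wedge\top\vdash A,\quad \delta^{\leftarrow}_A:A\vdash A\wedge\top,\quad \sigma^{\to}_A:\top\wedge A\vdash A,\quad \sigma^{\leftarrow}_A:A\vdash\top\wedge A,\quad c_{A,B}:A\wedge B\vdash B\wedge A,$$ $$r_x:\top\vdash x\equiv x,\qquad t_{x,y,z}:x\equiv y\wedge y\equiv z\vdash x\equiv z,\qquad s_{x,y}:x\equiv y\vdash y\equiv x,$$ by composition $g\circ f$ (when the target of $f$ is the source of $g$) and by $f\wedge g:A\wedge C\vdash B\wedge D$ for $f:A\vdash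 B$, $g:C\vdash D$. The category $S_\equiv$ has the formulae as objects; its arrows are the arrow terms modulo the smallest equivalence relation (between arrow terms of the same type) that is a congruence for $\circ$ and $\wedge$ and satisfies, for all indices and all $f,g,h,f_i,g_i$ of suitable types: * categorial equations: $\mathbf 1_B\circ f=f$, $f\circ\mathbf 1_A=f$, $(h\circ g)\circ f=h\circ(g\circ f)$; * bifunctoriality: $\mathbf 1_A\wedge\mathbf 1_B=\mathbf 1_{A\wedge B}$, $(g_1\circ f_1)\wedge(g_2\circ f_2)=(g_1\wedge g_2)\circ(f_1\wedge f_2)$; * naturality, for $f:A\vdash D$, $g:B\vdash E$, $h:C\vdash F$: $((f\wedge g)\wedge h)\circ b^{\to}_{A,B,C}=b^{\to}_{D,E,F}\circ(f\wedge(g\wedge h))$, $f\circ\delta^{\to}_A=\delta^{\to}_D\circ(f\wedge\mathbf 1_\top)$, $f\circ\sigma^{\to}_A=\sigma^{\to}_D\circ(\mathbf 1_\top\wedge f)$, $(g\wedge f)\circ c_{A,B}=c_{D,E}\circ(f\wedge g)$; * monoidal equations: $b^{\to}_{A,B,C}$ and $b^{\leftarrow}_{A,B,C}$ are mutually inverse,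 and so are $\delta^{\to}_A$ and $\delta^{\leftarrow}_A$, and $\sigma^{\to}_A$ and $\sigma^{\leftarrow}_A$; $b^{\to}_{A\wedge B,C,D}\circ b^{\to}_{A,B,C\wedge D}=(b^{\to}_{A,B,C}\wedge\mathbf 1_D)\circ b^{\to}_{A,B\wedge C,D}\circ(\mathbf 1_A\wedge b^{\to}_{B,C,D})$; $b^{\to}_{A,\top,C}=(\delta^{\leftarrow}_A\wedge\mathbf 1_C)\circ(\mathbf 1_A\wedge\sigma^{\to}_C)$; * symmetry: $c_{B,A}\circ c_{A,B}=\mathbf 1_{A\wedge B}$, $c_{A,B\wedge C}=b^{\to}_{B,C,A}\circ(\mathbf 1_B\wedge c_{A,C})\circ b^{\leftarrow}_{B,A,C}\circ(c_{A,B}\wedge\mathbf 1_C)\circ b^{\to}_{A,B,C}$; * $(rt\delta)$ $t_{x,y,y}\circ(\mathbf 1_{x\equiv y}\wedge r_y)=\delta^{\to}_{x\equiv y}$, $(rt\sigma)$ $t_{y,y,x}\circ(r_y\wedge\mathbf 1_{y\equiv x})=\sigma^{\to}_{y\equiv x}$, $(tb)$ $t_{x,y,u}\circ(\mathbf 1_{x\equiv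 y}\wedge t_{y,z,u})=t_{x,z,u}\circ(t_{x,y,z}\wedge\mathbf 1_{z\equiv u})\circ b^{\to}_{x\equiv y,y\equiv z,z\equiv u}$; * $(ss)$ $s_{y,x}\circ s_{x,y}=\mathbf 1_{x\equiv y}$, $(rs)$ $s_{x,x}\circ r_x=r_x$, $(ts)$ $s_{x,z}\circ t_{x,y,z}=t_{z,y,x}\circ(s_{y,z}\wedge s_{x,y})\circ c_{x\equiv y,y\equiv z}$. The category $\mathit{Br}$ has the finite ordinals as objects; an arrow $n\to m$ is an equivalence relation on the disjoint union $n\sqcup m$ all of whose classes have exactly two elements (a diagram with $n$ points at the top and $m$ points at the bottom, joined in pairs). Arrows are composed by vertical gluing of diagrams: two outer points are related in the composite iff they are connected by a path of edges in the glued diagram. The identities join the $i$-th point at the top to the $i$-th point at the bottom. The functor $G:S_\equiv\to\mathit{Br}$ sends a formula to the number of occurrences of variables in it (numbered from left to right). On primitive arrow terms, $G$ sends $\mathbf 1_A,b^{\to},b^{\leftarrow},\delta^{\to},\delta^{\leftarrow},\sigma^{\to},\sigma^{\leftarrow}$ to the diagrams joining corresponding occurrences in order; $c_{A,B}$ to the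 diagram joining, in order, the occurrences in $A$ (resp. $B$) in the source to those in $A$ (resp. $B$) in the target; $r_x$ to a cap joining the two points at the bottom; $t_{x,y,z}$ to the diagram with a cup joining the two occurrences of $y$ and edges joining the two $x$'s and the two $z$'s; $s_{x,y}$ to a crossing. Composition is sent to vertical composition, and $\wedge$ on arrows to horizontal juxtaposition of diagrams. Then $S_\equiv$ is coherent: the functor $G$ is faithful, i.e. for all $f,g:A\vdash B$, if $Gf=Gg$ then $f=g$ in $S_\equiv$. -/

import Mathlib

open CategoryTheory

universe u

/-! ### Diagrams: Brauerian split equivalences, and the category `Br` -/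

/-- A diagram between the set `X` (drawn at the top) and the set `Y` (drawn at the bottom):
an equivalence relation on the disjoint union of `X` and `Y` all of whose classes
have exactly two elements. The two elements of a class are joined by an edge. -/
@[ext]
structure Diagram (X Y : Type) where
  rel : Setoid (X ⊕ Y)
  pair : ∀ a, ∃! b, b ≠ a ∧ rel a b

namespace Diagram

variable {X Y Z U X' Y' Z' : Type}

/-- An inclusion between two relations with two-element classes is an equality. -/
theorem eq_of_le {D E : Diagram X Y} (h : ∀ a b, D.rel a b → E.rel a b) : D = E := by
  have key : ∀ a b, D.rel a b ↔ E.rel a b := by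
    intro a b
    refine ⟨h a b, fun hab => ?_⟩
    by_cases hba : b = a
    · subst hba; exact D.rel.refl _
    · obtain ⟨c, ⟨hca, hac⟩, -⟩ := D.pair a
      obtain ⟨e, -, hu⟩ := E.pair a
      rw [hu b ⟨hba, hab⟩, ← hu c ⟨hca, h _ _ hac⟩]
      exact hac
  cases D with
  | mk r hr =>
    cases E with
    | mk s hs =>
      congr
      exact Setoid.ext key

/-- The edges of two diagrams, one drawn above the other and sharing the middle set `Y`. -/
inductive Link (R : Setoid (X ⊕ Y)) (S : Setoid (Y ⊕ Z)) : X ⊕ Y ⊕ Z → X ⊕ Y ⊕ Z → Prop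
  | upper {a b : X ⊕ Y} : R a b → Link R S (Sum.map id Sum.inl a) (Sum.map id Sum.inl b)
  | lower {a b : Y ⊕ Z} : S a b → Link R S (Sum.inr a) (Sum.inr b)

/-- Vertical composition of relations: two points of the outer sets `X` and `Z` are related when
they are connected by a path of edges in the glued picture on `X ⊕ Y ⊕ Z`. -/
def compRel (R : Setoid (X ⊕ Y)) (S : Setoid (Y ⊕ Z)) : Setoid (X ⊕ Z) :=
  (Relation.EqvGen.setoid (Link R S)).comap (Sum.map id Sum.inr)

/-- An orbit of the group generated by two involutions that contains a point fixed
by one of them contains exactly two such points. -/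
theorem pair_aux {W : Type} [Finite W] (p q : W → W) (hp : Function.Involutive p)
    (hq : Function.Involutive q) (hne : ∀ w, ¬ (p w = w ∧ q w = w)) (x : W) (hx : q x = x) :
    ∃! y, y ≠ x ∧ (p y = y ∨ q y = y) ∧
      Relation.EqvGen (fun a b => p a = b ∨ q a = b) x y := by
  set P : Equiv.Perm W := hp.toPerm with hP
  set Q : Equiv.Perm W := hq.toPerm with hQ
  have hPi : P⁻¹ = P := by ext; rfl
  have hQi : Q⁻¹ = Q := by ext; rfl
  set π : Equiv.Perm W := Q * P with hπ
  have hQπ : ∀ k : ℤ, Q * π ^ k = π ^ (-k) * Q := by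
    intro k
    have h1 : Q * π * Q⁻¹ = π⁻¹ := by
      rw [hπ, mul_inv_rev, hQi, hPi]
      have : Q * Q = 1 := by nth_rewrite 1 [← hQi]; exact inv_mul_cancel Q
      rw [← mul_assoc, this, one_mul]
    rw [zpow_neg, ← inv_zpow, ← h1, conj_zpow, inv_mul_cancel_right]
  have hqk : ∀ k : ℤ, q ((π ^ k) x) = (π ^ (-k)) x := by
    intro k
    have := congrArg (fun f : Equiv.Perm W => f x) (hQπ k)
    simp only [Equiv.Perm.mul_apply] at this
    have hQx : Q x = x := hx
    rw [hQx] at this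
    exact this
  have hpq : ∀ w, p w = q (π w) := by
    intro w
    change p w = q (q (p w))
    rw [hq]
  have hpk : ∀ k : ℤ, p ((π ^ k) x) = (π ^ (-(k + 1))) x := by
    intro k
    rw [hpq, ← Equiv.Perm.mul_apply, ← zpow_one_add, add_comm, hqk]
  set N := Function.minimalPeriod (π • ·) x with hN
  have hfix : ∀ k : ℤ, (π ^ k) x = x ↔ (N : ℤ) ∣ k := fun k =>
    MulAction.zpow_smul_eq_iff_minimalPeriod_dvd (a := π) (b := x)
  have heq : ∀ k l : ℤ, (π ^ k) x = (π ^ l) x ↔ (N : ℤ) ∣ k - l := by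
    intro k l
    rw [← hfix, sub_eq_add_neg, add_comm, zpow_add, Equiv.Perm.mul_apply, zpow_neg,
      Equiv.Perm.inv_eq_iff_eq]
  have hqf : ∀ k : ℤ, q ((π ^ k) x) = (π ^ k) x ↔ (N : ℤ) ∣ 2 * k := by
    intro k
    rw [hqk, heq, ← dvd_neg]; ring_nf
  have hpf : ∀ k : ℤ, p ((π ^ k) x) = (π ^ k) x ↔ (N : ℤ) ∣ 2 * k + 1 := by
    intro k
    rw [hpk, heq, ← dvd_neg]; ring_nf
  have hN1 : ¬ (N : ℤ) ∣ 1 := by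
    intro h
    have := (hpf 0).2 (by simpa using h)
    exact hne x ⟨by simpa using this, hx⟩
  have hNpos : 0 < N := by
    have h1 : 0 < orderOf π := orderOf_pos π
    have : (N : ℤ) ∣ (orderOf π : ℤ) := by
      rw [← hfix, zpow_natCast, pow_orderOf_eq_one]; rfl
    rcases Nat.eq_zero_or_pos N with h | h
    · rw [h] at this
      have h0 := Int.natCast_dvd_natCast.1 this
      rw [zero_dvd_iff] at h0
      omega
    · exact h
  have horb : ∀ k : ℤ, Relation.EqvGen (fun a b => p a = b ∨ q a = b) x ((π ^ k) x) := by
    have step : ∀ w, Relation.EqvGen (fun a b => p a = b ∨ q a = b) w (π w) := fun w =>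
      .trans _ (p w) _ (.rel _ _ (Or.inl rfl)) (.rel _ _ (Or.inr rfl))
    intro k
    induction k using Int.induction_on with
    | zero => exact .refl _
    | succ i ih =>
      refine .trans _ _ _ ih ?_
      rw [add_comm, zpow_add, zpow_one]; exact step _
    | pred i ih =>
      refine .trans _ _ _ ih (.symm _ _ ?_)
      have := step ((π ^ (-(i : ℤ) - 1)) x)
      rwa [← Equiv.Perm.mul_apply, ← zpow_one_add, add_sub_cancel] at this
  have hrep : ∀ y, Relation.EqvGen (fun a b => p a = b ∨ q a = b) x y →
      ∃ k : ℤ, y = (π ^ k) x := by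
    have : ∀ a b, Relation.EqvGen (fun a b => p a = b ∨ q a = b) a b →
        ((∃ k : ℤ, a = (π ^ k) x) ↔ ∃ k : ℤ, b = (π ^ k) x) := by
      intro a b h
      induction h with
      | rel a b h =>
        rcases h with h | h
        · constructor
          · rintro ⟨k, rfl⟩; exact ⟨_, h.symm.trans (hpk k)⟩
          · rintro ⟨k, rfl⟩; exact ⟨_, (hp.eq_iff.1 h).trans (hpk k)⟩
        · constructor
          · rintro ⟨k, rfl⟩; exact ⟨_, h.symm.trans (hqk k)⟩
          · rintro ⟨k, rfl⟩; exact ⟨_, (hq.eq_iff.1 h).trans (hqk k)⟩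
      | refl => rfl
      | symm _ _ _ ih => exact ih.symm
      | trans _ _ _ _ _ h1 h2 => exact h1.trans h2
    intro y h
    exact (this x y h).1 ⟨0, rfl⟩
  have huniq : ∀ k l : ℤ, ((N : ℤ) ∣ 2 * k + 1 ∨ (N : ℤ) ∣ 2 * k) →
      ((N : ℤ) ∣ 2 * l + 1 ∨ (N : ℤ) ∣ 2 * l) → ¬ (N : ℤ) ∣ k → ¬ (N : ℤ) ∣ l →
      (N : ℤ) ∣ k - l := by
    intro k l hk hl hk0 hl0
    rcases Nat.even_or_odd' N with ⟨m, hm | hm⟩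
    · have hpar : ∀ j : ℤ, ¬ (N : ℤ) ∣ 2 * j + 1 := by
        rintro j ⟨c, hc⟩
        rw [hm] at hc; push_cast at hc
        have : (2 : ℤ) ∣ 1 := ⟨m * c - j, by linear_combination hc⟩
        omega
      obtain ⟨a, ha⟩ := hk.resolve_left (hpar k)
      obtain ⟨b, hb⟩ := hl.resolve_left (hpar l)
      have ha' : k = m * a := by rw [hm] at ha; push_cast at ha; linarith
      have hb' : l = m * b := by rw [hm] at hb; push_cast at hb; linarith
      have odd : ∀ c j : ℤ, j = m * c → ¬ (N : ℤ) ∣ j → c % 2 = 1 := by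
        intro c j hj hn
        by_contra hc
        have h2 : c = 2 * (c / 2) := by omega
        apply hn
        refine ⟨c / 2, ?_⟩
        rw [hj, hm]; push_cast
        linear_combination (m : ℤ) * h2
      have h1 := odd a k ha' hk0
      have h2 := odd b l hb' hl0
      have h3 : a - b = 2 * ((a - b) / 2) := by omega
      refine ⟨(a - b) / 2, ?_⟩
      rw [ha', hb', hm]; push_cast
      linear_combination (m : ℤ) * h3
    · have hc : IsCoprime (N : ℤ) 2 := ⟨1, -m, by rw [hm]; push_cast; ring⟩
      have hk' := hk.resolve_right (fun h => hk0 (hc.dvd_of_dvd_mul_left h))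
      have hl' := hl.resolve_right (fun h => hl0 (hc.dvd_of_dvd_mul_left h))
      apply hc.dvd_of_dvd_mul_left
      have := dvd_sub hk' hl'
      rwa [show 2 * k + 1 - (2 * l + 1) = 2 * (k - l) by ring] at this
  have hex : ∃ k : ℤ, ((N : ℤ) ∣ 2 * k + 1 ∨ (N : ℤ) ∣ 2 * k) ∧ ¬ (N : ℤ) ∣ k := by
    have small : ∀ m : ℕ, 0 < m → m < N → ¬ (N : ℤ) ∣ (m : ℤ) := by
      intro m h0 h1 h
      have := Nat.le_of_dvd h0 (Int.natCast_dvd_natCast.1 h)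
      omega
    rcases Nat.even_or_odd' N with ⟨m, hm | hm⟩
    · exact ⟨m, Or.inr ⟨1, by rw [hm]; push_cast; ring⟩, small m (by omega) (by omega)⟩
    · have hm0 : m ≠ 0 := by
        rintro rfl
        exact hN1 ⟨1, by rw [hm]; simp⟩
      exact ⟨m, Or.inl ⟨1, by rw [hm]; push_cast; ring⟩, small m (by omega) (by omega)⟩
  obtain ⟨k, hk, hk0⟩ := hex
  refine ⟨(π ^ k) x, ⟨fun h => hk0 ((hfix k).1 h), ?_, horb k⟩, ?_⟩
  · rw [hpf, hqf]; exact hk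
  · rintro y ⟨hyx, hy, hxy⟩
    obtain ⟨l, rfl⟩ := hrep y hxy
    rw [hpf, hqf] at hy
    exact (heq l k).2 (huniq l k hy hk (fun h => hyx ((hfix l).2 h)) hk0)

/-- The other end of the edge at a given point. -/
theorem exists_partner (D : Diagram X Y) : ∃ p : X ⊕ Y → X ⊕ Y, Function.Involutive p ∧
    (∀ a, p a ≠ a) ∧ ∀ a b, D.rel a b ↔ a = b ∨ p a = b := by
  choose p hp hu using D.pair
  have hrel : ∀ a b, D.rel a b ↔ a = b ∨ p a = b := by
    intro a b
    constructor
    · intro h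
      by_cases hba : b = a
      · exact Or.inl hba.symm
      · exact Or.inr (hu a b ⟨hba, h⟩).symm
    · rintro (rfl | rfl)
      · exact D.rel.refl _
      · exact (hp a).2
  refine ⟨p, fun a => ?_, fun a => (hp a).1, hrel⟩
  exact (hu (p a) a ⟨(hp a).1.symm, D.rel.symm (hp a).2⟩).symm

theorem pair_comp [Finite X] [Finite Y] [Finite Z] (D : Diagram X Y) (E : Diagram Y Z)
    (a : X ⊕ Z) : ∃! b, b ≠ a ∧ compRel D.rel E.rel a b := by
  obtain ⟨p, hp, hpne, hpr⟩ := D.exists_partner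
  obtain ⟨q, hq, hqne, hqr⟩ := E.exists_partner
  let e : (X ⊕ Y) ⊕ Z ≃ X ⊕ Y ⊕ Z := Equiv.sumAssoc X Y Z
  let p' : X ⊕ Y ⊕ Z → X ⊕ Y ⊕ Z := fun w => e (Sum.map p id (e.symm w))
  let q' : X ⊕ Y ⊕ Z → X ⊕ Y ⊕ Z := Sum.map id q
  have hincl : ∀ c : X ⊕ Y, Sum.map id Sum.inl c = e (Sum.inl c) := by
    rintro (c | c) <;> rfl
  have hp' : Function.Involutive p' := by
    intro w
    obtain ⟨v, rfl⟩ := e.surjective w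
    rcases v with c | c
    · simp [p', hp c]
    · simp [p']
  have hq' : Function.Involutive q' := by
    rintro (c | c)
    · simp [q']
    · simp [q', hq c]
  have hpf : ∀ w, p' w = w ↔ ∃ z : Z, w = Sum.inr (Sum.inr z) := by
    intro w
    obtain ⟨v, rfl⟩ := e.surjective w
    rcases v with (c | c) | c
    · simpa [p', e] using fun h => hpne (.inl c) (Sum.inl_injective (e.injective h))
    · simpa [p', e] using fun h => hpne (.inr c) (Sum.inl_injective (e.injective h))
    · simp [p', e]
  have hqf : ∀ w, q' w = w ↔ ∃ x : X, w = Sum.inl x := by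
    rintro (c | c)
    · simp [q']
    · simpa [q'] using hqne c
  have hne : ∀ w, ¬ (p' w = w ∧ q' w = w) := by
    rintro w ⟨h1, h2⟩
    obtain ⟨z, rfl⟩ := (hpf w).1 h1
    obtain ⟨x, hx⟩ := (hqf _).1 h2
    cases hx
  have hgen : ∀ u v, Relation.EqvGen (Link D.rel E.rel) u v ↔
      Relation.EqvGen (fun a b => p' a = b ∨ q' a = b) u v := by
    intro u v
    constructor
    · intro h
      induction h with
      | rel u v h =>
        cases h with
        | @upper c d h =>
          rcases (hpr c d).1 h with rfl | rfl
          · exact .refl _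
          · exact .rel _ _ (Or.inl (by simp [p', hincl]))
        | @lower c d h =>
          rcases (hqr c d).1 h with rfl | rfl
          · exact .refl _
          · exact .rel _ _ (Or.inr rfl)
      | refl => exact .refl _
      | symm _ _ _ ih => exact .symm _ _ ih
      | trans _ _ _ _ _ h1 h2 => exact .trans _ _ _ h1 h2
    · intro h
      induction h with
      | rel u v h =>
        rcases h with rfl | rfl
        · obtain ⟨w, rfl⟩ := e.surjective u
          rcases w with c | c
          · have : p' (e (Sum.inl c)) = e (Sum.inl (p c)) := by simp [p']
            rw [this, ← hincl, ← hincl]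
            exact .rel _ _ (.upper ((hpr _ _).2 (Or.inr rfl)))
          · have : p' (e (Sum.inr c)) = e (Sum.inr c) := by simp [p']
            rw [this]
            exact .refl _
        · rcases u with c | c
          · exact .refl _
          · exact .rel _ _ (.lower ((hqr _ _).2 (Or.inr rfl)))
      | refl => exact .refl _
      | symm _ _ _ ih => exact .symm _ _ ih
      | trans _ _ _ _ _ h1 h2 => exact .trans _ _ _ h1 h2
  have houter : ∀ w, (p' w = w ∨ q' w = w) ↔ ∃ c : X ⊕ Z, w = Sum.map id Sum.inr c := by
    intro w
    rw [hpf, hqf]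
    constructor
    · rintro (⟨z, rfl⟩ | ⟨x, rfl⟩)
      · exact ⟨.inr z, rfl⟩
      · exact ⟨.inl x, rfl⟩
    · rintro ⟨x | z, rfl⟩
      · exact Or.inr ⟨x, rfl⟩
      · exact Or.inl ⟨z, rfl⟩
  have hinj : Function.Injective (Sum.map id Sum.inr : X ⊕ Z → X ⊕ Y ⊕ Z) :=
    Function.injective_id.sumMap Sum.inr_injective
  have main : ∃! y, y ≠ Sum.map id Sum.inr a ∧ (p' y = y ∨ q' y = y) ∧
      Relation.EqvGen (fun a b => p' a = b ∨ q' a = b) (Sum.map id Sum.inr a) y := by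
    rcases (houter (Sum.map id Sum.inr a)).2 ⟨a, rfl⟩ with h | h
    · have := pair_aux q' p' hq' hp' (fun w hw => hne w hw.symm) _ h
      simpa only [or_comm] using this
    · exact pair_aux p' q' hp' hq' hne _ h
  obtain ⟨y, ⟨hy1, hy2, hy3⟩, hyu⟩ := main
  obtain ⟨b, rfl⟩ := (houter y).1 hy2
  refine ⟨b, ⟨fun h => hy1 (by rw [h]), (hgen _ _).2 hy3⟩, ?_⟩
  rintro c ⟨hc1, hc2⟩
  exact hinj (hyu _ ⟨fun h => hc1 (hinj h), (houter _).2 ⟨c, rfl⟩, (hgen _ _).1 hc2⟩)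

/-- Vertical composition of diagrams, the first one drawn above the second one
(closed loops, if there were any, are deleted). -/
def comp [Finite X] [Finite Y] [Finite Z] (D : Diagram X Y) (E : Diagram Y Z) : Diagram X Z where
  rel := compRel D.rel E.rel
  pair := pair_comp D E

/-- Horizontal composition: the two diagrams are drawn side by side. -/
def tensor (D : Diagram X Y) (E : Diagram X' Y') : Diagram (X ⊕ X') (Y ⊕ Y') where
  rel := Setoid.comap (Equiv.sumSumSumComm X X' Y Y')
    { r := Sum.LiftRel D.rel E.rel
      iseqv :=
        { refl := by rintro (a | a) <;> constructor <;> apply Setoid.refl'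
          symm := by rintro _ _ (h | h) <;> constructor <;> exact Setoid.symm' _ h
          trans := by
            rintro _ _ _ (h | h) (h' | h') <;> constructor <;> exact Setoid.trans' _ h h' } }
  pair := by
    intro a
    obtain ⟨w, rfl⟩ := (Equiv.sumSumSumComm X X' Y Y').symm.surjective a
    simp only [Setoid.comap_rel, (Equiv.sumSumSumComm X X' Y Y').symm.bijective.existsUnique_iff,
      Equiv.apply_symm_apply, ne_eq, EmbeddingLike.apply_eq_iff_eq]
    rcases w with c | c
    · obtain ⟨d, ⟨hd1, hd2⟩, hu⟩ := D.pair c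
      refine ⟨.inl d, ⟨fun h => hd1 (Sum.inl_injective h), .inl hd2⟩, ?_⟩
      rintro _ ⟨h1, h2 | h2⟩
      exact congrArg _ (hu _ ⟨fun h => h1 (congrArg _ h), h2⟩)
    · obtain ⟨d, ⟨hd1, hd2⟩, hu⟩ := E.pair c
      refine ⟨.inr d, ⟨fun h => hd1 (Sum.inr_injective h), .inr hd2⟩, ?_⟩
      rintro _ ⟨h1, h2 | h2⟩
      exact congrArg _ (hu _ ⟨fun h => h1 (congrArg _ h), h2⟩)

/-- The diagram without cups and caps that joins each `x` at the top to `e x` at the bottom. -/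
def ofEquiv (e : X ≃ Y) : Diagram X Y where
  rel := Setoid.ker (Sum.elim e id)
  pair := by
    rintro (x | y)
    · refine ⟨.inr (e x), ⟨by simp, by simp [Setoid.ker_def]⟩, ?_⟩
      rintro (b | b) <;> simp +contextual [Setoid.ker_def, eq_comm]
    · refine ⟨.inl (e.symm y), ⟨by simp, by simp [Setoid.ker_def]⟩, ?_⟩
      rintro (b | b) <;> simp +contextual [Setoid.ker_def, eq_comm]

/-- The cap: nothing at the top, the two points at the bottom are joined. -/
def cap : Diagram (Fin 0) (Fin 2) where
  rel := ⊤
  pair := by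
    rintro (a | a)
    · exact a.elim0
    · refine ⟨.inr (1 - a), ⟨?_, trivial⟩, ?_⟩
      · revert a; decide
      · rintro (b | b) ⟨h, -⟩
        · exact b.elim0
        · revert a b; decide

/-- Two points of the diagram for transitivity are joined exactly when they carry the same
number: the points at the top are numbered `0, 1` and `1, 2`, those at the bottom `0, 2`. -/
def transLabel : (Fin 2 ⊕ Fin 2) ⊕ Fin 2 → Fin 3 :=
  Sum.elim (Sum.elim ![0, 1] ![1, 2]) ![0, 2]

/-- The diagram for transitivity: a cup joins the two middle points at the top,
and the outer points at the top are joined to those at the bottom in the same order. -/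
def trans : Diagram (Fin 2 ⊕ Fin 2) (Fin 2) where
  rel := Setoid.ker transLabel
  pair := by
    simp only [Setoid.ker_def]
    unfold ExistsUnique
    decide

/-- Renaming of the points of a diagram along bijections. -/
def reindex (e : X ≃ X') (e' : Y ≃ Y') (D : Diagram X Y) : Diagram X' Y' where
  rel := D.rel.comap (Equiv.sumCongr e e').symm
  pair := by
    intro a
    obtain ⟨w, rfl⟩ := (Equiv.sumCongr e e').surjective a
    obtain ⟨d, ⟨hd1, hd2⟩, hu⟩ := D.pair w
    refine ⟨Equiv.sumCongr e e' d, ⟨fun h => hd1 ((Equiv.sumCongr e e').injective h), ?_⟩, ?_⟩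
    · rw [Setoid.comap_rel, Equiv.symm_apply_apply, Equiv.symm_apply_apply]; exact hd2
    · rintro y ⟨h1, h2⟩
      obtain ⟨v, rfl⟩ := (Equiv.sumCongr e e').surjective y
      rw [Setoid.comap_rel, Equiv.symm_apply_apply, Equiv.symm_apply_apply] at h2
      rw [hu v ⟨fun h => h1 (by rw [h]), h2⟩]

theorem rel_of_mk_eq {A : Type} {r : Setoid A} {a b : A}
    (h : Quotient.mk r a = Quotient.mk r b) : r a b := Quotient.exact h

theorem ofEquiv_rel (e : X ≃ Y) (a b : X ⊕ Y) :
    (ofEquiv e).rel a b ↔ Sum.elim e id a = Sum.elim e id b := Iff.rfl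

/-- A composition is determined by any labelling of the glued picture that is constant
along edges and separates the edges of the result. -/
theorem comp_eq_of_label [Finite X] [Finite Y] [Finite Z] {D : Diagram X Y} {E : Diagram Y Z}
    {F : Diagram X Z} {L : Type} (l : X ⊕ Y ⊕ Z → L)
    (h1 : ∀ a b, D.rel a b → l (Sum.map id Sum.inl a) = l (Sum.map id Sum.inl b))
    (h2 : ∀ a b, E.rel a b → l (Sum.inr a) = l (Sum.inr b))
    (h3 : ∀ a b, l (Sum.map id Sum.inr a) = l (Sum.map id Sum.inr b) → F.rel a b) :
    D.comp E = F := by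
  apply eq_of_le
  intro a b h
  apply h3
  have key : ∀ u v, Relation.EqvGen (Link D.rel E.rel) u v → l u = l v := by
    intro u v h
    induction h with
    | rel u v h =>
      cases h with
      | upper h => exact h1 _ _ h
      | lower h => exact h2 _ _ h
    | refl => rfl
    | symm _ _ _ ih => exact ih.symm
    | trans _ _ _ _ _ i1 i2 => exact i1.trans i2
  exact key _ _ h

theorem ofEquiv_comp [Finite X] [Finite Y] [Finite Z] (e : X ≃ Y) (D : Diagram Y Z) :
    (ofEquiv e).comp D = reindex e.symm (Equiv.refl Z) D := by
  refine comp_eq_of_label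
    (l := Sum.elim (fun x => Quotient.mk D.rel (.inl (e x))) (Quotient.mk D.rel)) ?_ ?_ ?_
  · rintro (a | a) (b | b) h <;> simp_all [ofEquiv_rel]
  · intro a b h
    exact Quotient.sound h
  · rintro (a | a) (b | b) h <;> (have h' := rel_of_mk_eq (r := D.rel) h; exact h')

theorem comp_ofEquiv [Finite X] [Finite Y] [Finite Z] (D : Diagram X Y) (e : Y ≃ Z) :
    D.comp (ofEquiv e) = reindex (Equiv.refl X) e D := by
  refine comp_eq_of_label
    (l := Sum.elim (fun x => Quotient.mk D.rel (.inl x))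
      (Sum.elim (fun y => Quotient.mk D.rel (.inr y))
        (fun z => Quotient.mk D.rel (.inr (e.symm z))))) ?_ ?_ ?_
  · rintro (a | a) (b | b) h <;> exact Quotient.sound h
  · rintro (a | a) (b | b) h <;> rw [ofEquiv_rel] at h <;> simp at h <;> subst h <;> simp
  · rintro (a | a) (b | b) h <;> (have h' := rel_of_mk_eq (r := D.rel) h; exact h')

theorem reindex_refl (D : Diagram X Y) : reindex (Equiv.refl X) (Equiv.refl Y) D = D := by
  apply eq_of_le
  rintro (a | a) (b | b) h <;> exact h

theorem reindex_ofEquiv (e : X ≃ X') (e' : Y ≃ Y') (f : X ≃ Y) :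
    reindex e e' (ofEquiv f) = ofEquiv ((e.symm.trans f).trans e') := by
  apply eq_of_le
  intro a b h
  change Sum.elim f id ((Equiv.sumCongr e e').symm a) =
    Sum.elim f id ((Equiv.sumCongr e e').symm b) at h
  rw [ofEquiv_rel]
  apply e'.symm.injective
  rcases a with a | a <;> rcases b with b | b <;> simpa using h

theorem ofEquiv_comp_ofEquiv [Finite X] [Finite Y] [Finite Z] (e : X ≃ Y) (f : Y ≃ Z) :
    (ofEquiv e).comp (ofEquiv f) = ofEquiv (e.trans f) := by
  rw [ofEquiv_comp, reindex_ofEquiv]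
  rfl

theorem id_comp [Finite X] [Finite Y] (D : Diagram X Y) :
    (ofEquiv (Equiv.refl X)).comp D = D := by
  rw [ofEquiv_comp]; exact reindex_refl D

theorem comp_id [Finite X] [Finite Y] (D : Diagram X Y) :
    D.comp (ofEquiv (Equiv.refl Y)) = D := by
  rw [comp_ofEquiv]; exact reindex_refl D

/-- Connectedness in a glued picture, tested by properties that are constant along edges. -/
theorem eqvGen_of_forall {W : Type} {r : W → W → Prop} {u v : W}
    (h : ∀ f : W → Prop, (∀ a b, r a b → (f a ↔ f b)) → (f u ↔ f v)) :
    Relation.EqvGen r u v := by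
  refine (h (fun w => Relation.EqvGen r u w) ?_).1 (.refl _)
  intro a b hab
  exact ⟨fun h => .trans _ _ _ h (.rel _ _ hab), fun h => .trans _ _ _ h (.symm _ _ (.rel _ _ hab))⟩

theorem eqvGen_iff_of_forall {W : Type} {r : W → W → Prop} {u v : W} (f : W → Prop)
    (h : ∀ a b, r a b → (f a ↔ f b)) (huv : Relation.EqvGen r u v) : f u ↔ f v := by
  induction huv with
  | rel a b hab => exact h _ _ hab
  | refl => rfl
  | symm _ _ _ ih => exact ih.symm
  | trans _ _ _ _ _ i1 i2 => exact i1.trans i2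

theorem comp_assoc [Finite X] [Finite Y] [Finite Z] [Finite U] (D : Diagram X Y)
    (E : Diagram Y Z) (F : Diagram Z U) : (D.comp E).comp F = D.comp (E.comp F) := by
  apply eq_of_le
  intro a b hab
  apply eqvGen_of_forall
  intro f hf
  -- `f` lives on `X ⊕ Y ⊕ U`; it is extended to `Z` through the paths in `Y ⊕ Z ⊕ U`
  let g : Y ⊕ Z ⊕ U → Prop := fun w =>
    ∃ c : Y ⊕ U, f (.inr c) ∧ Relation.EqvGen (Link E.rel F.rel) (Sum.map id Sum.inr c) w
  have hg : ∀ w w', Link E.rel F.rel w w' → (g w ↔ g w') := by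
    intro w w' h
    constructor
    · rintro ⟨c, h1, h2⟩; exact ⟨c, h1, .trans _ _ _ h2 (.rel _ _ h)⟩
    · rintro ⟨c, h1, h2⟩; exact ⟨c, h1, .trans _ _ _ h2 (.symm _ _ (.rel _ _ h))⟩
  have hgf : ∀ c : Y ⊕ U, g (Sum.map id Sum.inr c) ↔ f (.inr c) := by
    intro c
    constructor
    · rintro ⟨d, h1, h2⟩
      exact (hf _ _ (.lower (a := d) (b := c) h2)).1 h1
    · intro h; exact ⟨c, h, .refl _⟩
  let k : X ⊕ Y ⊕ Z ⊕ U → Prop := Sum.elim (fun x => f (.inl x)) g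
  have hk : ∀ c d : X ⊕ Z, (D.comp E).rel c d →
      (k (Sum.map id (fun z => .inr (.inl z)) c) ↔ k (Sum.map id (fun z => .inr (.inl z)) d)) := by
    intro c d h
    have := eqvGen_iff_of_forall
      (fun w : X ⊕ Y ⊕ Z => k (Sum.map id (Sum.map id Sum.inl) w)) ?_ h
    · rcases c with c | c <;> rcases d with d | d <;> exact this
    · intro w w' hw
      cases hw with
      | @upper s s' h =>
        have h' := hf _ _ (.upper h)
        have e : ∀ s : X ⊕ Y, k (Sum.map id (Sum.map id Sum.inl) (Sum.map id Sum.inl s)) ↔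
            f (Sum.map id Sum.inl s) := by
          rintro (s | s)
          · exact Iff.rfl
          · exact hgf (.inl s)
        rw [e, e]; exact h'
      | @lower s s' h => exact hg _ _ (.upper h)
  have := eqvGen_iff_of_forall
    (fun w : X ⊕ Z ⊕ U => k (Sum.map id Sum.inr w)) ?_ hab
  · have e : ∀ s : X ⊕ U, k (Sum.map id Sum.inr (Sum.map id Sum.inr s)) ↔
        f (Sum.map id Sum.inr s) := by
      rintro (s | s)
      · exact Iff.rfl
      · exact hgf (.inr s)
    rw [e, e] at this
    exact this
  · intro w w' hw
    cases hw with
    | @upper s s' h =>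
      have := hk _ _ h
      rcases s with s | s <;> rcases s' with s' | s' <;> exact this
    | @lower s s' h => exact hg _ _ (.lower h)

theorem reindex_comp [Finite X] [Finite Y] [Finite Z] [Finite X'] [Finite Y'] [Finite Z']
    (e : X ≃ X') (e' : Y ≃ Y') (e'' : Z ≃ Z') (D : Diagram X Y) (E : Diagram Y Z) :
    reindex e e'' (D.comp E) = (reindex e e' D).comp (reindex e' e'' E) := by
  symm
  refine comp_eq_of_label (l := fun w => Quotient.mk (Relation.EqvGen.setoid (Link D.rel E.rel))
    (Sum.map e.symm (Sum.map e'.symm e''.symm) w)) ?_ ?_ ?_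
  · intro a b h
    apply Quotient.sound
    have := Relation.EqvGen.rel _ _ (Link.upper (S := E.rel) h)
    rcases a with a | a <;> rcases b with b | b <;> exact this
  · intro a b h
    exact Quotient.sound (Relation.EqvGen.rel _ _ (Link.lower (R := D.rel) h))
  · intro a b h
    have := Quotient.exact h
    rcases a with a | a <;> rcases b with b | b <;> exact this

theorem tensor_comp [Finite X] [Finite Y] [Finite Z] [Finite X'] [Finite Y'] [Finite Z']
    (D : Diagram X Y) (E : Diagram Y Z) (D' : Diagram X' Y') (E' : Diagram Y' Z') :
    tensor (D.comp E) (D'.comp E') = (tensor D D').comp (tensor E E') := by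
  symm
  refine comp_eq_of_label (l := fun w => Sum.map
    (Quotient.mk (Relation.EqvGen.setoid (Link D.rel E.rel)))
    (Quotient.mk (Relation.EqvGen.setoid (Link D'.rel E'.rel)))
    (Sum.elim (Sum.map Sum.inl Sum.inl)
      (Sum.elim (Sum.map (Sum.inr ∘ Sum.inl) (Sum.inr ∘ Sum.inl))
        (Sum.map (Sum.inr ∘ Sum.inr) (Sum.inr ∘ Sum.inr))) w)) ?_ ?_ ?_
  · rintro ((a | a) | (a | a)) ((b | b) | (b | b)) h <;> first
      | cases h; done
      | exact congrArg Sum.inl (Quotient.sound (Relation.EqvGen.rel _ _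
          (Link.upper (S := E.rel) (Sum.liftRel_inl_inl.1 h))))
      | exact congrArg Sum.inr (Quotient.sound (Relation.EqvGen.rel _ _
          (Link.upper (S := E'.rel) (Sum.liftRel_inr_inr.1 h))))
  · rintro ((a | a) | (a | a)) ((b | b) | (b | b)) h <;> first
      | cases h; done
      | exact congrArg Sum.inl (Quotient.sound (Relation.EqvGen.rel _ _
          (Link.lower (R := D.rel) (Sum.liftRel_inl_inl.1 h))))
      | exact congrArg Sum.inr (Quotient.sound (Relation.EqvGen.rel _ _
          (Link.lower (R := D'.rel) (Sum.liftRel_inr_inr.1 h))))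
  · rintro ((a | a) | (a | a)) ((b | b) | (b | b)) h <;> first
      | (cases h)
      | (have h' := rel_of_mk_eq (Sum.inl_injective h); exact Sum.LiftRel.inl h')
      | (have h' := rel_of_mk_eq (Sum.inr_injective h); exact Sum.LiftRel.inr h')

theorem assoc_nat [Finite X] [Finite Y] [Finite Z] [Finite X'] [Finite Y'] [Finite Z']
    (D : Diagram X X') (E : Diagram Y Y') (F : Diagram Z Z') :
    (ofEquiv (Equiv.sumAssoc X Y Z).symm).comp (tensor (tensor D E) F) =
      (tensor D (tensor E F)).comp (ofEquiv (Equiv.sumAssoc X' Y' Z').symm) := by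
  rw [ofEquiv_comp, comp_ofEquiv]
  apply eq_of_le
  rintro ((a | a | a) | ((a | a) | a)) ((b | b | b) | ((b | b) | b)) h <;> first
    | cases h; done
    | (have h' := Sum.liftRel_inl_inl.1 h; have h'' := Sum.liftRel_inl_inl.1 h'; exact .inl h'')
    | (have h' := Sum.liftRel_inl_inl.1 h; have h'' := Sum.liftRel_inr_inr.1 h';
       exact .inr (.inl h''))
    | (have h' := Sum.liftRel_inr_inr.1 h; exact .inr (.inr h'))
    | (have h' := Sum.liftRel_inl_inl.1 h; cases h')

theorem comm_nat [Finite X] [Finite Y] [Finite X'] [Finite Y']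
    (D : Diagram X X') (E : Diagram Y Y') :
    (ofEquiv (Equiv.sumComm X Y)).comp (tensor E D) =
      (tensor D E).comp (ofEquiv (Equiv.sumComm X' Y')) := by
  rw [ofEquiv_comp, comp_ofEquiv]
  apply eq_of_le
  rintro ((a | a) | (a | a)) ((b | b) | (b | b)) h <;> first
    | cases h; done
    | (have h' := Sum.liftRel_inl_inl.1 h; exact .inr h')
    | (have h' := Sum.liftRel_inr_inr.1 h; exact .inl h')

theorem sumEmpty_nat [Finite X] [Finite X'] (D : Diagram X X') :
    (ofEquiv (Equiv.sumEmpty X (Fin 0))).comp D =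
      (tensor D (ofEquiv (Equiv.refl (Fin 0)))).comp (ofEquiv (Equiv.sumEmpty X' (Fin 0))) := by
  rw [ofEquiv_comp, comp_ofEquiv]
  apply eq_of_le
  rintro ((a | a) | a) ((b | b) | b) h <;> first
    | exact a.elim0
    | exact b.elim0
    | exact .inl h

theorem emptySum_nat [Finite X] [Finite X'] (D : Diagram X X') :
    (ofEquiv (Equiv.emptySum (Fin 0) X)).comp D =
      (tensor (ofEquiv (Equiv.refl (Fin 0))) D).comp (ofEquiv (Equiv.emptySum (Fin 0) X')) := by
  rw [ofEquiv_comp, comp_ofEquiv]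
  apply eq_of_le
  rintro ((a | a) | a) ((b | b) | b) h <;> first
    | exact a.elim0
    | exact b.elim0
    | exact .inr h

theorem trans_rel (a b : (Fin 2 ⊕ Fin 2) ⊕ Fin 2) :
    trans.rel a b ↔ transLabel a = transLabel b := Iff.rfl

theorem trans_cap_right :
    (tensor (ofEquiv (Equiv.refl (Fin 2))) cap).comp trans =
      ofEquiv (Equiv.sumEmpty (Fin 2) (Fin 0)) := by
  refine comp_eq_of_label (l := Sum.elim (Sum.elim ![0, 1] Fin.elim0)
    (Sum.elim (Sum.elim ![0, 1] ![1, 1]) ![(0 : Fin 2), 1])) ?_ ?_ ?_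
  · rintro ((a | a) | (a | a)) ((b | b) | (b | b)) h <;> first
      | exact a.elim0
      | exact b.elim0
      | cases h; done
      | (have h' := Sum.liftRel_inl_inl.1 h; cases h'; rfl)
      | (clear h; revert a b; decide)
  · simp only [trans_rel]; decide
  · simp only [ofEquiv_rel]; decide

theorem trans_cap_left :
    (tensor cap (ofEquiv (Equiv.refl (Fin 2)))).comp trans =
      ofEquiv (Equiv.emptySum (Fin 0) (Fin 2)) := by
  refine comp_eq_of_label (l := Sum.elim (Sum.elim Fin.elim0 ![0, 1])
    (Sum.elim (Sum.elim ![0, 0] ![0, 1]) ![(0 : Fin 2), 1])) ?_ ?_ ?_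
  · rintro ((a | a) | (a | a)) ((b | b) | (b | b)) h <;> first
      | exact a.elim0
      | exact b.elim0
      | cases h; done
      | (have h' := Sum.liftRel_inr_inr.1 h; cases h'; rfl)
      | (clear h; revert a b; decide)
  · simp only [trans_rel]; decide
  · simp only [ofEquiv_rel]; decide

/-- Two points of the diagram for two successive transitivities are joined exactly when they
carry the same number. -/
def transLabel₂ : (Fin 2 ⊕ Fin 2 ⊕ Fin 2) ⊕ Fin 2 → Fin 4 :=
  Sum.elim (Sum.elim ![0, 1] (Sum.elim ![1, 2] ![2, 3])) ![0, 3]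

/-- The diagram for two successive transitivities. -/
def trans₂ : Diagram (Fin 2 ⊕ Fin 2 ⊕ Fin 2) (Fin 2) where
  rel := Setoid.ker transLabel₂
  pair := by
    simp only [Setoid.ker_def]
    unfold ExistsUnique
    decide

theorem trans₂_rel (a b : (Fin 2 ⊕ Fin 2 ⊕ Fin 2) ⊕ Fin 2) :
    trans₂.rel a b ↔ transLabel₂ a = transLabel₂ b := Iff.rfl

theorem trans_assoc_left :
    (tensor (ofEquiv (Equiv.refl (Fin 2))) trans).comp trans = trans₂ := by
  refine comp_eq_of_label (l := Sum.elim (Sum.elim ![0, 1] (Sum.elim ![1, 2] ![2, 3]))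
    (Sum.elim (Sum.elim ![0, 1] ![1, 3]) ![(0 : Fin 4), 3])) ?_ ?_ ?_
  · rintro ((a | a) | (a | a)) ((b | b) | (b | b)) h <;> first
      | cases h; done
      | (have h' := Sum.liftRel_inl_inl.1 h; cases h'; rfl)
      | (have h' := (trans_rel _ _).1 (Sum.liftRel_inr_inr.1 h); clear h; revert a b; decide)
  · simp only [trans_rel]; decide
  · simp only [trans₂_rel]; decide

theorem trans_assoc_right :
    (ofEquiv (Equiv.sumAssoc (Fin 2) (Fin 2) (Fin 2)).symm).comp
      ((tensor trans (ofEquiv (Equiv.refl (Fin 2)))).comp trans) = trans₂ := by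
  rw [← comp_assoc, ofEquiv_comp]
  refine comp_eq_of_label (l := Sum.elim (Sum.elim ![0, 1] (Sum.elim ![1, 2] ![2, 3]))
    (Sum.elim (Sum.elim ![0, 2] ![2, 3]) ![(0 : Fin 4), 3])) ?_ ?_ ?_
  · rintro ((a | a | a) | (a | a)) ((b | b | b) | (b | b)) h <;> first
      | cases h; done
      | (have h' := Sum.liftRel_inr_inr.1 h; cases h'; rfl)
      | (have h' := Sum.liftRel_inl_inl.1 h
         have h'' := (trans_rel _ _).1 h'
         clear h h'; revert a b; decide)
  · simp only [trans_rel]; decide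
  · simp only [trans₂_rel]; decide

theorem cap_swap : cap.comp (ofEquiv (Equiv.swap 0 1)) = cap := by
  rw [comp_ofEquiv]
  apply eq_of_le
  intro _ _ _
  trivial

theorem trans_swap :
    trans.comp (ofEquiv (Equiv.swap 0 1)) =
      (ofEquiv (Equiv.sumComm (Fin 2) (Fin 2))).comp
        ((ofEquiv (Equiv.sumCongr (Equiv.swap (0 : Fin 2) 1) (Equiv.swap (0 : Fin 2) 1))).comp
          trans) := by
  rw [comp_ofEquiv, ofEquiv_comp, ofEquiv_comp]
  apply eq_of_le
  intro a b
  change transLabel _ = transLabel _ → transLabel _ = transLabel _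
  revert a b
  decide

theorem tensor_ofEquiv (e : X ≃ Y) (e' : X' ≃ Y') :
    tensor (ofEquiv e) (ofEquiv e') = ofEquiv (Equiv.sumCongr e e') := by
  apply eq_of_le
  rintro ((a | a) | (a | a)) ((b | b) | (b | b)) h <;> first
    | cases h; done
    | (have h' := Sum.liftRel_inl_inl.1 h; exact congrArg Sum.inl h')
    | (have h' := Sum.liftRel_inr_inr.1 h; exact congrArg Sum.inr h')

end Diagram

/-- The category `Br`: the objects are the finite ordinals `n = {0, …, n - 1}`. -/
structure Br where
  card : ℕ

/-- The arrows of `Br` from `n` to `m` are the equivalence relations with two-element classes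
on the disjoint union of `n` and `m`, composed vertically. -/
instance : Category Br where
  Hom n m := Diagram (Fin n.card) (Fin m.card)
  id n := Diagram.ofEquiv (Equiv.refl (Fin n.card))
  comp D E := Diagram.comp D E
  id_comp := Diagram.id_comp
  comp_id := Diagram.comp_id
  assoc := Diagram.comp_assoc

/-! ### The category `S_≡` -/

/-- The formulae over the set `V` of variables: `⊤`, `x ≡ y` and `A ∧ B`. -/
inductive Formula (V : Type u) : Type u
  | top : Formula V
  | eqv (x y : V) : Formula V
  | and (A B : Formula V) : Formula V

section

open Formula

/-- The arrow terms `f : A ⊢ B` of `S_≡`. -/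
inductive ArrowTerm {V : Type u} : Formula V → Formula V → Type u
  /-- `1_A` -/
  | one (A : Formula V) : ArrowTerm A A
  /-- `b^→` -/
  | bR (A B C : Formula V) : ArrowTerm (and A (and B C)) (and (and A B) C)
  /-- `b^←` -/
  | bL (A B C : Formula V) : ArrowTerm (and (and A B) C) (and A (and B C))
  /-- `δ^→` -/
  | δR (A : Formula V) : ArrowTerm (and A top) A
  /-- `δ^←` -/
  | δL (A : Formula V) : ArrowTerm A (and A top)
  /-- `σ^→` -/
  | σR (A : Formula V) : ArrowTerm (and top A) A
  /-- `σ^←` -/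
  | σL (A : Formula V) : ArrowTerm A (and top A)
  /-- symmetry of conjunction -/
  | c (A B : Formula V) : ArrowTerm (and A B) (and B A)
  /-- reflexivity -/
  | r (x : V) : ArrowTerm top (eqv x x)
  /-- transitivity -/
  | t (x y z : V) : ArrowTerm (and (eqv x y) (eqv y z)) (eqv x z)
  /-- symmetry of equality -/
  | s (x y : V) : ArrowTerm (eqv x y) (eqv y x)
  /-- `f ∧ g` -/
  | conj {A B C D : Formula V} (f : ArrowTerm A B) (g : ArrowTerm C D) :
      ArrowTerm (and A C) (and B D)
  /-- `g ∘ f` -/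
  | comp {A B C : Formula V} (g : ArrowTerm B C) (f : ArrowTerm A B) : ArrowTerm A C

namespace ArrowTerm

variable {V : Type u}

infixr:80 " ⊚ " => ArrowTerm.comp
infixr:85 " ⋏ " => ArrowTerm.conj

/-- Equality of arrow terms in `S_≡`: the smallest equivalence relation on arrow terms of the
same type that is a congruence for composition and conjunction and satisfies the equations
of symmetric monoidal categories and the specific equations for `r`, `t` and `s`. -/
inductive Eqn : {A B : Formula V} → ArrowTerm A B → ArrowTerm A B → Prop
  | refl {A B : Formula V} (f : ArrowTerm A B) : Eqn f f
  | symm {A B : Formula V} {f g : ArrowTerm A B} : Eqn f g → Eqn g f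
  | trans {A B : Formula V} {f g h : ArrowTerm A B} : Eqn f g → Eqn g h → Eqn f h
  | conj_congr {A B C D : Formula V} {f₁ g₁ : ArrowTerm A B} {f₂ g₂ : ArrowTerm C D} :
      Eqn f₁ g₁ → Eqn f₂ g₂ → Eqn (f₁ ⋏ f₂) (g₁ ⋏ g₂)
  | comp_congr {A B C : Formula V} {f₁ g₁ : ArrowTerm A B} {f₂ g₂ : ArrowTerm B C} :
      Eqn f₁ g₁ → Eqn f₂ g₂ → Eqn (f₂ ⊚ f₁) (g₂ ⊚ g₁)
  -- categorial equations
  | cat1_left {A B : Formula V} (f : ArrowTerm A B) : Eqn (one B ⊚ f) f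
  | cat1_right {A B : Formula V} (f : ArrowTerm A B) : Eqn (f ⊚ one A) f
  | cat2 {A B C D : Formula V} (f : ArrowTerm A B) (g : ArrowTerm B C) (h : ArrowTerm C D) :
      Eqn ((h ⊚ g) ⊚ f) (h ⊚ (g ⊚ f))
  -- bifunctoriality equations
  | conj1 (A B : Formula V) : Eqn (one A ⋏ one B) (one (and A B))
  | conj2 {A₁ B₁ C₁ A₂ B₂ C₂ : Formula V} (f₁ : ArrowTerm A₁ B₁) (g₁ : ArrowTerm B₁ C₁)
      (f₂ : ArrowTerm A₂ B₂) (g₂ : ArrowTerm B₂ C₂) :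
      Eqn ((g₁ ⊚ f₁) ⋏ (g₂ ⊚ f₂)) ((g₁ ⋏ g₂) ⊚ (f₁ ⋏ f₂))
  -- naturality equations
  | b_nat {A B C D E F : Formula V} (f : ArrowTerm A D) (g : ArrowTerm B E) (h : ArrowTerm C F) :
      Eqn (((f ⋏ g) ⋏ h) ⊚ bR A B C) (bR D E F ⊚ (f ⋏ (g ⋏ h)))
  | δ_nat {A D : Formula V} (f : ArrowTerm A D) : Eqn (f ⊚ δR A) (δR D ⊚ (f ⋏ one top))
  | σ_nat {A D : Formula V} (f : ArrowTerm A D) : Eqn (f ⊚ σR A) (σR D ⊚ (one top ⋏ f))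
  | c_nat {A B D E : Formula V} (f : ArrowTerm A D) (g : ArrowTerm B E) :
      Eqn ((g ⋏ f) ⊚ c A B) (c D E ⊚ (f ⋏ g))
  -- specific equations of monoidal categories
  | bb_left (A B C : Formula V) : Eqn (bL A B C ⊚ bR A B C) (one (and A (and B C)))
  | bb_right (A B C : Formula V) : Eqn (bR A B C ⊚ bL A B C) (one (and (and A B) C))
  | b5 (A B C D : Formula V) :
      Eqn (bR (and A B) C D ⊚ bR A B (and C D))
        ((bR A B C ⋏ one D) ⊚ bR A (and B C) D ⊚ (one A ⋏ bR B C D))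
  | δδ_left (A : Formula V) : Eqn (δL A ⊚ δR A) (one (and A top))
  | δδ_right (A : Formula V) : Eqn (δR A ⊚ δL A) (one A)
  | σσ_left (A : Formula V) : Eqn (σL A ⊚ σR A) (one (and top A))
  | σσ_right (A : Formula V) : Eqn (σR A ⊚ σL A) (one A)
  | bδσ (A C : Formula V) : Eqn (bR A top C) ((δL A ⋏ one C) ⊚ (one A ⋏ σR C))
  -- specific equations of symmetric monoidal categories
  | cc (A B : Formula V) : Eqn (c B A ⊚ c A B) (one (and A B))
  | bc (A B C : Formula V) :
      Eqn (c A (and B C))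
        (bR B C A ⊚ (one B ⋏ c A C) ⊚ bL B A C ⊚ (c A B ⋏ one C) ⊚ bR A B C)
  -- specific equations for reflexivity and transitivity
  | rtδ (x y : V) : Eqn (t x y y ⊚ (one (eqv x y) ⋏ r y)) (δR (eqv x y))
  | rtσ (x y : V) : Eqn (t y y x ⊚ (r y ⋏ one (eqv y x))) (σR (eqv y x))
  | tb (x y z u : V) :
      Eqn (t x y u ⊚ (one (eqv x y) ⋏ t y z u))
        (t x z u ⊚ (t x y z ⋏ one (eqv z u)) ⊚ bR (eqv x y) (eqv y z) (eqv z u))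
  -- specific equations for symmetry
  | ss (x y : V) : Eqn (s y x ⊚ s x y) (one (eqv x y))
  | rs (x : V) : Eqn (s x x ⊚ r x) (r x)
  | ts (x y z : V) :
      Eqn (s x z ⊚ t x y z) (t z y x ⊚ (s y z ⋏ s x y) ⊚ c (eqv x y) (eqv y z))

instance setoid (A B : Formula V) : Setoid (ArrowTerm A B) where
  r := Eqn
  iseqv := ⟨Eqn.refl, Eqn.symm, Eqn.trans⟩

end ArrowTerm

end

section

open Formula ArrowTerm

/-- The objects of the category `S_≡` over the set `V` of variables are the formulae. -/
structure SEquiv (V : Type u) : Type u where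
  formula : Formula V

namespace SEquiv

variable {V : Type u}

/-- The arrows of `S_≡` are the arrow terms modulo equality. -/
instance : Category (SEquiv V) where
  Hom A B := Quotient (ArrowTerm.setoid A.formula B.formula)
  id A := Quotient.mk _ (one A.formula)
  comp := Quotient.map₂ (fun f g => g ⊚ f) (fun _ _ hf _ _ hg => Eqn.comp_congr hf hg)
  id_comp := by rintro A B ⟨f⟩; exact Quotient.sound (Eqn.cat1_right f)
  comp_id := by rintro A B ⟨f⟩; exact Quotient.sound (Eqn.cat1_left f)
  assoc := by rintro A B C D ⟨f⟩ ⟨g⟩ ⟨h⟩; exact Quotient.sound (Eqn.symm (Eqn.cat2 f g h))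

/-- The arrow of `S_≡` given by an arrow term. -/
def arrow {A B : Formula V} (f : ArrowTerm A B) : (⟨A⟩ : SEquiv V) ⟶ ⟨B⟩ :=
  Quotient.mk _ f

/-- The operation `∧` on the arrows of `S_≡`. -/
def conjHom {A B C D : SEquiv V} : (A ⟶ B) → (C ⟶ D) →
    ((⟨and A.formula C.formula⟩ : SEquiv V) ⟶ ⟨and B.formula D.formula⟩) :=
  Quotient.map₂ (fun f g => f ⋏ g) (fun _ _ hf _ _ hg => Eqn.conj_congr hf hg)

theorem conjHom_comp {A₁ B₁ C₁ A₂ B₂ C₂ : SEquiv V} (f₁ : A₁ ⟶ B₁) (f₂ : A₂ ⟶ B₂)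
    (g₁ : B₁ ⟶ C₁) (g₂ : B₂ ⟶ C₂) :
    conjHom (f₁ ≫ g₁) (f₂ ≫ g₂) = conjHom f₁ f₂ ≫ conjHom g₁ g₂ := by
  rcases f₁ with ⟨f₁⟩; rcases f₂ with ⟨f₂⟩; rcases g₁ with ⟨g₁⟩; rcases g₂ with ⟨g₂⟩
  exact Quotient.sound (Eqn.conj2 f₁ g₁ f₂ g₂)

def associator (A B C : SEquiv V) :
    (⟨and (and A.formula B.formula) C.formula⟩ : SEquiv V) ≅
      ⟨and A.formula (and B.formula C.formula)⟩ where
  hom := arrow (bL _ _ _)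
  inv := arrow (bR _ _ _)
  hom_inv_id := Quotient.sound (Eqn.bb_right _ _ _)
  inv_hom_id := Quotient.sound (Eqn.bb_left _ _ _)

def leftUnitor (A : SEquiv V) : (⟨and top A.formula⟩ : SEquiv V) ≅ A where
  hom := arrow (σR _)
  inv := arrow (σL _)
  hom_inv_id := Quotient.sound (Eqn.σσ_left _)
  inv_hom_id := Quotient.sound (Eqn.σσ_right _)

def rightUnitor (A : SEquiv V) : (⟨and A.formula top⟩ : SEquiv V) ≅ A where
  hom := arrow (δR _)
  inv := arrow (δL _)
  hom_inv_id := Quotient.sound (Eqn.δδ_left _)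
  inv_hom_id := Quotient.sound (Eqn.δδ_right _)

theorem conjHom_id (A B : SEquiv V) : conjHom (𝟙 A) (𝟙 B) = 𝟙 _ :=
  Quotient.sound (Eqn.conj1 _ _)

/-- The iso `1 ∧ i`. -/
def whiskerLeftIso (A : SEquiv V) {B C : SEquiv V} (i : B ≅ C) :
    (⟨and A.formula B.formula⟩ : SEquiv V) ≅ ⟨and A.formula C.formula⟩ where
  hom := conjHom (𝟙 A) i.hom
  inv := conjHom (𝟙 A) i.inv
  hom_inv_id := by rw [← conjHom_comp, i.hom_inv_id, Category.comp_id, conjHom_id]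
  inv_hom_id := by rw [← conjHom_comp, i.inv_hom_id, Category.comp_id, conjHom_id]

/-- The iso `i ∧ 1`. -/
def whiskerRightIso {B C : SEquiv V} (i : B ≅ C) (A : SEquiv V) :
    (⟨and B.formula A.formula⟩ : SEquiv V) ≅ ⟨and C.formula A.formula⟩ where
  hom := conjHom i.hom (𝟙 A)
  inv := conjHom i.inv (𝟙 A)
  hom_inv_id := by rw [← conjHom_comp, i.hom_inv_id, Category.comp_id, conjHom_id]
  inv_hom_id := by rw [← conjHom_comp, i.inv_hom_id, Category.comp_id, conjHom_id]

/-- `S_≡` is a monoidal category. -/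
instance : MonoidalCategory (SEquiv V) where
  tensorObj A B := ⟨and A.formula B.formula⟩
  tensorUnit := ⟨top⟩
  tensorHom f g := conjHom f g
  whiskerLeft A _ _ f := conjHom (𝟙 A) f
  whiskerRight f A := conjHom f (𝟙 A)
  associator := associator
  leftUnitor := leftUnitor
  rightUnitor := rightUnitor
  tensorHom_def f g := by
    change conjHom f g = conjHom f (𝟙 _) ≫ conjHom (𝟙 _) g
    rw [← conjHom_comp, Category.comp_id, Category.id_comp]
  id_tensorHom_id := conjHom_id
  tensorHom_comp_tensorHom f₁ f₂ g₁ g₂ := (conjHom_comp f₁ f₂ g₁ g₂).symm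
  whiskerLeft_id := conjHom_id
  id_whiskerRight := conjHom_id
  associator_naturality {A B C D E F} f g h := by
    change conjHom (conjHom f g) h ≫ (associator D E F).hom =
      (associator A B C).hom ≫ conjHom f (conjHom g h)
    rw [← Iso.eq_comp_inv, Category.assoc, ← Iso.inv_comp_eq]
    rcases f with ⟨f⟩; rcases g with ⟨g⟩; rcases h with ⟨h⟩
    exact Quotient.sound (Eqn.b_nat f g h)
  leftUnitor_naturality f := by
    rcases f with ⟨f⟩
    exact Quotient.sound (Eqn.symm (Eqn.σ_nat f))
  rightUnitor_naturality f := by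
    rcases f with ⟨f⟩
    exact Quotient.sound (Eqn.symm (Eqn.δ_nat f))
  pentagon A B C D := by
    have h : ((associator A B ⟨and C.formula D.formula⟩).symm ≪≫
        (associator ⟨and A.formula B.formula⟩ C D).symm) =
        (whiskerLeftIso A (associator B C D)).symm ≪≫
        (associator A ⟨and B.formula C.formula⟩ D).symm ≪≫
        (whiskerRightIso (associator A B C) D).symm := by
      ext
      have := Eqn.b5 A.formula B.formula C.formula D.formula
      exact Quotient.sound (this.trans (Eqn.symm (Eqn.cat2 _ _ _)))
    have h2 := congrArg Iso.inv h
    simp only [Iso.trans_inv, Iso.symm_inv, Category.assoc] at h2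
    exact h2.symm
  triangle A B := by
    change (associator A ⟨top⟩ B).hom ≫ (whiskerLeftIso A (leftUnitor B)).hom =
      (whiskerRightIso (rightUnitor A) B).hom
    rw [← Iso.eq_inv_comp, ← Iso.comp_inv_eq]
    exact Quotient.sound (Eqn.symm (Eqn.bδσ _ _))

def braiding (A B : SEquiv V) :
    (⟨and A.formula B.formula⟩ : SEquiv V) ≅ ⟨and B.formula A.formula⟩ where
  hom := arrow (c _ _)
  inv := arrow (c _ _)
  hom_inv_id := Quotient.sound (Eqn.cc _ _)
  inv_hom_id := Quotient.sound (Eqn.cc _ _)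

theorem braiding_naturality {A B D E : SEquiv V} (f : A ⟶ D) (g : B ⟶ E) :
    conjHom f g ≫ (braiding D E).hom = (braiding A B).hom ≫ conjHom g f := by
  rcases f with ⟨f⟩; rcases g with ⟨g⟩
  exact Quotient.sound (Eqn.symm (Eqn.c_nat f g))

theorem hexagon (A B C : SEquiv V) :
    associator A B C ≪≫ braiding A ⟨and B.formula C.formula⟩ ≪≫ associator B C A =
      whiskerRightIso (braiding A B) C ≪≫ associator B A C ≪≫ whiskerLeftIso B (braiding A C) := by
  ext
  have h : (braiding A ⟨and B.formula C.formula⟩).hom =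
      ((((associator A B C).inv ≫ (whiskerRightIso (braiding A B) C).hom) ≫
        (associator B A C).hom) ≫ (whiskerLeftIso B (braiding A C)).hom) ≫
        (associator B C A).inv :=
    Quotient.sound (Eqn.bc A.formula B.formula C.formula)
  simp only [Iso.trans_hom, h, Category.assoc, Iso.hom_inv_id_assoc, Iso.inv_hom_id,
    Category.comp_id]

/-- `S_≡` is a symmetric monoidal category. -/
instance : SymmetricCategory (SEquiv V) where
  braiding := braiding
  braiding_naturality_right A _ _ f := braiding_naturality (𝟙 A) f
  braiding_naturality_left f A := braiding_naturality f (𝟙 A)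
  hexagon_forward A B C := congrArg Iso.hom (hexagon A B C)
  hexagon_reverse A B C := by
    have h := congrArg Iso.inv (hexagon C A B)
    simp only [Iso.trans_inv, Category.assoc] at h
    exact h
  symmetry A B := (braiding A B).hom_inv_id

end SEquiv

/-! ### The functor `G` from `S_≡` to `Br` -/

variable {V : Type u}

namespace Formula

/-- The set of occurrences of variables in a formula
(in `x ≡ y` there are two of them, the left one `0` and the right one `1`). -/
def Occ : Formula V → Type
  | top => Fin 0
  | eqv _ _ => Fin 2
  | and A B => Occ A ⊕ Occ B

/-- The number of occurrences of variables in a formula. -/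
def size : Formula V → ℕ
  | top => 0
  | eqv _ _ => 2
  | and A B => size A + size B

/-- The enumeration of the occurrences of variables in a formula from left to right. -/
def enum : (A : Formula V) → Occ A ≃ Fin (size A)
  | top => Equiv.refl (Fin 0)
  | eqv _ _ => Equiv.refl (Fin 2)
  | and A B => (Equiv.sumCongr (enum A) (enum B)).trans finSumFinEquiv

instance (A : Formula V) : Finite (Occ A) := Finite.of_equiv _ (enum A).symm

end Formula

namespace ArrowTerm

/-- The diagram of an arrow term. -/
def diagram : {A B : Formula V} → ArrowTerm A B → Diagram (Occ A) (Occ B)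
  | _, _, one A => Diagram.ofEquiv (Equiv.refl (Occ A))
  | _, _, bR A B C => Diagram.ofEquiv (Equiv.sumAssoc (Occ A) (Occ B) (Occ C)).symm
  | _, _, bL A B C => Diagram.ofEquiv (Equiv.sumAssoc (Occ A) (Occ B) (Occ C))
  | _, _, δR A => Diagram.ofEquiv (Equiv.sumEmpty (Occ A) (Fin 0))
  | _, _, δL A => Diagram.ofEquiv (Equiv.sumEmpty (Occ A) (Fin 0)).symm
  | _, _, σR A => Diagram.ofEquiv (Equiv.emptySum (Fin 0) (Occ A))
  | _, _, σL A => Diagram.ofEquiv (Equiv.emptySum (Fin 0) (Occ A)).symm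
  | _, _, c A B => Diagram.ofEquiv (Equiv.sumComm (Occ A) (Occ B))
  | _, _, r _ => Diagram.cap
  | _, _, t _ _ _ => Diagram.trans
  | _, _, s _ _ => Diagram.ofEquiv (X := Fin 2) (Y := Fin 2) (Equiv.swap 0 1)
  | _, _, conj f g => Diagram.tensor (diagram f) (diagram g)
  | _, _, comp g f => Diagram.comp (diagram f) (diagram g)

/-- Equal arrow terms have equal diagrams. -/
theorem diagram_eq {A B : Formula V} {f g : ArrowTerm A B} (h : Eqn f g) :
    diagram f = diagram g := by
  have perm : ∀ {X Y : Type} {e e' : X ≃ Y}, (∀ x, e x = e' x) →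
      Diagram.ofEquiv e = Diagram.ofEquiv e' := fun h => congrArg _ (Equiv.ext h)
  induction h with
  | refl => rfl
  | symm _ ih => exact ih.symm
  | trans _ _ ih₁ ih₂ => exact ih₁.trans ih₂
  | conj_congr _ _ ih₁ ih₂ => exact congrArg₂ Diagram.tensor ih₁ ih₂
  | comp_congr _ _ ih₁ ih₂ => exact congrArg₂ Diagram.comp ih₁ ih₂
  | cat1_left f => exact Diagram.comp_id _
  | cat1_right f => exact Diagram.id_comp _
  | cat2 f g h => exact (Diagram.comp_assoc _ _ _).symm
  | conj1 A B =>
    refine (Diagram.tensor_ofEquiv _ _).trans (perm ?_)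
    rintro (x | x) <;> rfl
  | conj2 f₁ g₁ f₂ g₂ => exact Diagram.tensor_comp _ _ _ _
  | b_nat f g h => exact Diagram.assoc_nat _ _ _
  | δ_nat f => exact Diagram.sumEmpty_nat _
  | σ_nat f => exact Diagram.emptySum_nat _
  | c_nat f g => exact Diagram.comm_nat _ _
  | bb_left A B C =>
    refine (Diagram.ofEquiv_comp_ofEquiv _ _).trans (perm ?_)
    rintro (x | x | x) <;> rfl
  | bb_right A B C =>
    refine (Diagram.ofEquiv_comp_ofEquiv _ _).trans (perm ?_)
    rintro ((x | x) | x) <;> rfl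
  | b5 A B C D =>
    simp only [diagram]
    erw [Diagram.tensor_ofEquiv, Diagram.tensor_ofEquiv, Diagram.ofEquiv_comp_ofEquiv,
      Diagram.ofEquiv_comp_ofEquiv, Diagram.ofEquiv_comp_ofEquiv]
    apply perm
    rintro (x | x | x | x) <;> rfl
  | δδ_left A =>
    refine (Diagram.ofEquiv_comp_ofEquiv _ _).trans (perm ?_)
    rintro (x | x)
    · rfl
    · exact Fin.elim0 x
  | δδ_right A =>
    exact (Diagram.ofEquiv_comp_ofEquiv _ _).trans (perm fun x => rfl)
  | σσ_left A =>
    refine (Diagram.ofEquiv_comp_ofEquiv _ _).trans (perm ?_)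
    rintro (x | x)
    · exact Fin.elim0 x
    · rfl
  | σσ_right A =>
    exact (Diagram.ofEquiv_comp_ofEquiv _ _).trans (perm fun x => rfl)
  | bδσ A C =>
    simp only [diagram]
    erw [Diagram.tensor_ofEquiv, Diagram.tensor_ofEquiv, Diagram.ofEquiv_comp_ofEquiv]
    apply perm
    rintro (x | x | x)
    · rfl
    · exact Fin.elim0 x
    · rfl
  | cc A B =>
    refine (Diagram.ofEquiv_comp_ofEquiv _ _).trans (perm ?_)
    rintro (x | x) <;> rfl
  | bc A B C =>
    simp only [diagram]
    erw [Diagram.tensor_ofEquiv, Diagram.tensor_ofEquiv, Diagram.ofEquiv_comp_ofEquiv,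
      Diagram.ofEquiv_comp_ofEquiv, Diagram.ofEquiv_comp_ofEquiv, Diagram.ofEquiv_comp_ofEquiv]
    apply perm
    rintro (x | x | x) <;> rfl
  | rtδ x y => exact Diagram.trans_cap_right
  | rtσ x y => exact Diagram.trans_cap_left
  | tb x y z u =>
    refine Diagram.trans_assoc_left.trans ?_
    refine Diagram.trans_assoc_right.symm.trans (Diagram.comp_assoc _ _ _).symm
  | ss x y =>
    refine (Diagram.ofEquiv_comp_ofEquiv _ _).trans (perm ?_)
    intro (x : Fin 2)
    change Equiv.swap 0 1 (Equiv.swap 0 1 x) = x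
    simp
  | rs x => exact Diagram.cap_swap
  | ts x y z =>
    refine Diagram.trans_swap.trans ?_
    rw [← Diagram.tensor_ofEquiv]
    exact (Diagram.comp_assoc _ _ _).symm

end ArrowTerm

/-- The functor `G` from `S_≡` to `Br`: a formula is sent to the number of occurrences of variables
in it, and an arrow to the diagram of any arrow term for it, the occurrences of variables in the
source and in the target being numbered from left to right. -/
def SEquiv.G (V : Type u) : SEquiv V ⥤ Br where
  obj A := ⟨size A.formula⟩
  map {A B} := Quotient.lift
    (fun f => Diagram.reindex (enum A.formula) (enum B.formula) (diagram f))
    (fun _ _ h => congrArg _ (diagram_eq h))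
  map_id A := by
    refine (Diagram.reindex_ofEquiv _ _ _).trans (congrArg Diagram.ofEquiv (Equiv.ext ?_))
    intro x
    exact (enum A.formula).apply_symm_apply x
  map_comp := by
    rintro A B C ⟨f⟩ ⟨g⟩
    exact Diagram.reindex_comp _ _ _ _ _

end

/-! Read an atom `x ≡ y` of the source as an edge of a graph joining the variables `x` and `y`. An
arrow into `x ≡ z` is then a walk from `x` to `z`: reflexivity is the empty walk, transitivity is
concatenation, and symmetry reverses a walk. Nothing can be copied or discarded, so an arrow `A ⊢ B`
amounts to one walk for each atom of `B`, and these walks together use every atom of `A` exactly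
once. The symmetric monoidal structure only distributes the atoms of `A` among the walks.

`IsNormal A B d U f` says that `f`, defined on the product of the atoms of `A` in `U`, is assembled
in this way from the lists `d`. Three facts give faithfulness.

Every arrow out of `A` becomes normal after precomposition with an isomorphism onto `A`. That
isomorphism is normal (`exists_isNormal_fullIso`), and normality survives composition with any arrow
term (`IsNormal.exists_comp`). Here (rtδ), (rtσ) and (tb) serve for concatenation, and (ss), (rs)
and (ts) for reversal.

The lists `d` determine the arrow (`IsNormal.unique`).

The diagram determines the lists (`IsNormal.traces`). Starting from the left end of an atom of `B`,
follow its edge to an occurrence in `A`, jump to the other side of that atom, follow the edge there,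
and continue until the right end of the atom of `B` is reached. Each point lies on one edge, so
nothing is left to choice (`Traces.unique`). Hence the lists never have to be computed: their
existence is enough. -/

section

open MonoidalCategory

universe v w

variable {V : Type u}

/-! ### Atoms of a formula and partitions of sets of atoms. -/

/-- The set of occurrences of atomic formulae `x ≡ y` in a formula. -/
def Formula.At : Formula V → Type
  | .top => Empty
  | .eqv _ _ => Unit
  | .and A B => At A ⊕ At B

open Formula

/-- A set of atoms of a formula. -/
abbrev Mask (A : Formula V) := At A → Bool

namespace Mask

/-- The atoms of a set that belong to the first conjunct. -/
abbrev fst {A B : Formula V} (U : Mask (A.and B)) : Mask A := fun a => U (.inl a)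

/-- The atoms of a set that belong to the second conjunct. -/
abbrev snd {A B : Formula V} (U : Mask (A.and B)) : Mask B := fun a => U (.inr a)

/-- `U` is the disjoint union of `S` and `T`. -/
def Split {A : Formula V} (U S T : Mask A) : Prop :=
  ∀ a, U a = (S a || T a) ∧ (S a && T a) = false

/-- `U` has no elements. -/
def Void {A : Formula V} (U : Mask A) : Prop := ∀ a, U a = false

/-- The only element of `U` is `a`. -/
def Single {A : Formula V} (U : Mask A) (a : At A) : Prop := ∀ b, U b = true ↔ b = a

/-- All atoms belong to `U`. -/
def Full {A : Formula V} (U : Mask A) : Prop := ∀ a, U a = true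

variable {A B : Formula V}

theorem Split.symm {U S T : Mask A} (h : Split U S T) : Split U T S := fun a =>
  ⟨by rw [(h a).1, Bool.or_comm], by rw [← (h a).2, Bool.and_comm]⟩

theorem Split.inl {U S T : Mask (A.and B)} (h : Split U S T) :
    Split U.fst S.fst T.fst := fun a => h (.inl a)

theorem Split.inr {U S T : Mask (A.and B)} (h : Split U S T) :
    Split U.snd S.snd T.snd := fun a => h (.inr a)

theorem Void.inl {U : Mask (A.and B)} (h : Void U) : Void U.fst :=
  fun a => h (.inl a)

theorem Void.inr {U : Mask (A.and B)} (h : Void U) : Void U.snd :=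
  fun a => h (.inr a)

theorem Full.inl {U : Mask (A.and B)} (h : Full U) : Full U.fst :=
  fun a => h (.inl a)

theorem Full.inr {U : Mask (A.and B)} (h : Full U) : Full U.snd :=
  fun a => h (.inr a)

theorem Single.inl {U : Mask (A.and B)} {a : At A} (h : Single U (.inl a)) :
    Single U.fst a :=
  fun b => (h (.inl b)).trans Sum.inl_injective.eq_iff

theorem Single.inr {U : Mask (A.and B)} {a : At B} (h : Single U (.inr a)) :
    Single U.snd a :=
  fun b => (h (.inr b)).trans Sum.inr_injective.eq_iff

theorem Single.void_inr {U : Mask (A.and B)} {a : At A} (h : Single U (.inl a)) :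
    Void U.snd :=
  fun b => Bool.eq_false_iff.2 fun hb => Sum.inr_ne_inl ((h (.inr b)).1 hb)

theorem Single.void_inl {U : Mask (A.and B)} {a : At B} (h : Single U (.inr a)) :
    Void U.fst :=
  fun b => Bool.eq_false_iff.2 fun hb => Sum.inl_ne_inr ((h (.inl b)).1 hb)

theorem Split.eq_of_void_left {U S T : Mask A} (h : Split U S T) (hS : Void S) : U = T := by
  funext a
  rw [(h a).1, hS a, Bool.false_or]

theorem split_of_void_left {S : Mask A} (T : Mask A) (hS : Void S) : Split T S T := fun a => by
  rw [hS a]; simp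

/-- Given `U` and `S`, the other part can only be the complement. With `Single.unique`, this lets a
list of atoms fix all the partitions occurring in a walk. -/
theorem Split.eq_right {U S T T' : Mask A} (h : Split U S T) (h' : Split U S T') : T = T' := by
  funext a
  have h1 := h a
  have h2 := h' a
  revert h1 h2
  cases U a <;> cases S a <;> cases T a <;> cases T' a <;> simp

theorem Single.unique {S S' : Mask A} {a : At A} (h : Single S a) (h' : Single S' a) :
    S = S' := by
  funext b
  rw [Bool.eq_iff_iff, h b, h' b]

/-- Reassociation of a disjoint union of three sets. -/
theorem Split.assoc_right {U P R S T : Mask A} (h : Split U P R) (h' : Split P S T) :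
    ∃ Q, Split U S Q ∧ Split Q T R := by
  refine ⟨fun a => T a || R a, fun a => ?_, fun a => ?_⟩
  all_goals dsimp only
  all_goals
    have h1 := h a
    have h2 := h' a
    revert h1 h2
    cases U a <;> cases P a <;> cases R a <;> cases S a <;> cases T a <;>
      simp +decide

theorem Split.assoc_left {U Q R S T : Mask A} (h : Split U S Q) (h' : Split Q T R) :
    ∃ P, Split U P R ∧ Split P S T := by
  obtain ⟨P, h1, h2⟩ := h.symm.assoc_right h'.symm
  exact ⟨P, h1.symm, h2.symm⟩

end Mask

open Mask

/-! ### Splitting a product along a partition of its factors -/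

/-- The crossing inside `tensorμ` must equal its own inverse, so a mere braiding would not do. This
is the inductive step in the commutativity of splitting. -/
theorem tensorμ_braiding {C : Type w} [Category.{v} C] [MonoidalCategory C] [SymmetricCategory C]
    (X₁ X₂ Y₁ Y₂ : C) :
    tensorμ X₁ X₂ Y₁ Y₂ ≫ (β_ (X₁ ⊗ Y₁) (X₂ ⊗ Y₂)).hom =
      ((β_ X₁ X₂).hom ⊗ₘ (β_ Y₁ Y₂).hom) ≫ tensorμ X₂ X₁ Y₂ Y₁ := by
  simp [tensorμ, SymmetricCategory.braiding_swap_eq_inv_braiding Y₁ X₂,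
    MonoidalCategory.tensorHom_def]

variable {C : Type w} [Category.{v} C] [MonoidalCategory C] (E : V → V → C)

/-- An atom, if it is selected, and otherwise the unit. -/
def atomObj (x y : V) : Bool → C
  | true => E x y
  | false => 𝟙_ C

/-- The product of the selected atoms of a formula, with units in the places of the other atoms. -/
def maskObj : (A : Formula V) → Mask A → C
  | .top, _ => 𝟙_ C
  | .eqv x y, U => atomObj E x y (U ())
  | .and A B, U => maskObj A U.fst ⊗ maskObj B U.snd

/-- The other five Boolean triples contradict the last argument. -/
def atomSplit (x y : V) : (u s t : Bool) → u = (s || t) ∧ (s && t) = false →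
    (atomObj E x y u ⟶ atomObj E x y s ⊗ atomObj E x y t)
  | true, true, false, _ => (ρ_ (E x y)).inv
  | true, false, true, _ => (λ_ (E x y)).inv
  | false, false, false, _ => (λ_ (𝟙_ C)).inv

def atomCounit (x y : V) : (u : Bool) → u = false → (atomObj E x y u ⟶ 𝟙_ C)
  | false, _ => 𝟙 _

def maskCounit : (A : Formula V) → (U : Mask A) → Void U → (maskObj E A U ⟶ 𝟙_ C)
  | .top, _, _ => 𝟙 _
  | .eqv x y, U, h => atomCounit E x y (U ()) (h ())
  | .and A B, _, h => (maskCounit A _ h.inl ⊗ₘ maskCounit B _ h.inr) ≫ (λ_ (𝟙_ C)).hom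

variable [BraidedCategory C]

/-- The canonical arrow that splits the product of `U` into those of `S` and `T`. -/
def maskSplit : (A : Formula V) → (U S T : Mask A) → Split U S T →
    (maskObj E A U ⟶ maskObj E A S ⊗ maskObj E A T)
  | .top, _, _, _, _ => (λ_ (𝟙_ C)).inv
  | .eqv x y, _, _, _, h => atomSplit E x y _ _ _ (h ())
  | .and A B, _, _, _, h =>
    (maskSplit A _ _ _ h.inl ⊗ₘ maskSplit B _ _ _ h.inr) ≫ tensorμ _ _ _ _

/-- Splitting and counit behave like a cocommutative coalgebra graded by partitions: this is the
unit law, `maskSplit_coassoc` is coassociativity and `maskSplit_braiding` cocommutativity. Normal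
forms need nothing else about partitions. -/
theorem maskSplit_counit_left (A : Formula V) {U S : Mask A} (h : Split U S U) (hS : Void S) :
    maskSplit E A U S U h ≫ (maskCounit E A S hS ⊗ₘ 𝟙 _) ≫ (λ_ _).hom = 𝟙 _ := by
  induction A with
  | top => simp [maskSplit, maskCounit, maskObj]
  | eqv x y =>
    simp only [maskSplit, maskCounit, maskObj]
    -- The proofs mention the Booleans; once they are variables, the Booleans can be replaced and
    -- split into cases.
    generalize h () = h1
    have h2 := hS ()
    change S () = false at h2
    generalize hs : hS () = h3
    clear hs
    revert h1 h3
    generalize U () = a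
    generalize S () = b at h2
    intro h1 h3
    subst h2
    cases a <;> simp [atomSplit, atomCounit, atomObj]
  | and A B ihA ihB =>
    have h1 := ihA h.inl hS.inl
    have h2 := ihB h.inr hS.inr
    simp only [maskSplit, maskCounit, maskObj, Category.assoc]
    -- The counits slide past `tensorμ` by naturality, and `leftUnitor_monoidal` then separates the
    -- two conjuncts.
    rw [comp_tensor_id, ← id_tensorHom_id, Category.assoc, ← reassoc_of% tensorμ_natural,
      id_tensorHom_id, tensorHom_id (λ_ (𝟙_ C)).hom,
      ← leftUnitor_monoidal, tensorHom_comp_tensorHom, tensorHom_comp_tensorHom,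
      h1, h2, id_tensorHom_id]

theorem maskSplit_coassoc (A : Formula V) {U P Q R S T : Mask A} (h1 : Split U P R)
    (h2 : Split P S T) (h3 : Split U S Q) (h4 : Split Q T R) :
    maskSplit E A U P R h1 ≫ (maskSplit E A P S T h2 ⊗ₘ 𝟙 _) ≫ (α_ _ _ _).hom =
      maskSplit E A U S Q h3 ≫ (𝟙 _ ⊗ₘ maskSplit E A Q T R h4) := by
  induction A with
  | top => simp [maskSplit, maskObj]; monoidal
  | eqv x y =>
    simp only [maskSplit, maskObj]
    generalize h1 () = g1
    generalize h2 () = g2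
    generalize h3 () = g3
    generalize h4 () = g4
    revert g1 g2 g3 g4
    -- A single atom goes to at most one part. In the consistent cases both sides consist of unitors
    -- and associators only, so coherence closes them.
    cases U () <;> cases P () <;> cases Q () <;> cases R () <;> cases S () <;> cases T () <;>
      intro g1 g2 g3 g4 <;> first
      | (exfalso; revert g1 g2 g3 g4; decide)
      | (simp only [atomSplit, atomObj]; monoidal)
  | and A B ihA ihB =>
    have i1 := ihA h1.inl h2.inl h3.inl h4.inl
    have i2 := ihB h1.inr h2.inr h3.inr h4.inr
    simp only [maskSplit, maskObj, Category.assoc]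
    rw [comp_tensor_id, ← id_tensorHom_id, Category.assoc, ← reassoc_of% tensorμ_natural,
      id_tensorHom_id, tensorHom_id (tensorμ _ _ _ _),
      associator_monoidal, tensorHom_comp_tensorHom_assoc, tensorHom_comp_tensorHom_assoc,
      Category.assoc, Category.assoc, i1, i2]
    rw [id_tensor_comp, ← id_tensorHom_id, ← reassoc_of% tensorμ_natural, id_tensorHom_id,
      id_tensorHom (_ ⊗ _), tensorHom_comp_tensorHom_assoc]

end

/-! ### Commutativity of splitting, in a symmetric monoidal category. -/

section

open MonoidalCategory Mask

universe v w

variable {V : Type u} {C : Type w} [Category.{v} C] [MonoidalCategory C] [SymmetricCategory C]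
  (E : V → V → C)

theorem maskSplit_braiding (A : Formula V) {U S T : Mask A} (h : Split U S T) :
    maskSplit E A U S T h ≫ (β_ _ _).hom = maskSplit E A U T S h.symm := by
  induction A with
  | top => simp [maskSplit, maskObj, ← unitors_equal]
  | eqv x y =>
    simp only [maskSplit, maskObj]
    generalize h () = g1
    generalize h.symm () = g2
    revert g1 g2
    cases U () <;> cases S () <;> cases T () <;>
      intro g1 g2 <;> first
      | (exfalso; revert g1 g2; decide)
      | (simp [atomSplit, atomObj, braiding_tensorUnit_left, braiding_tensorUnit_right,
          ← unitors_equal])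
  | and A B ihA ihB =>
    simp only [maskSplit, maskObj, Category.assoc]
    rw [tensorμ_braiding, tensorHom_comp_tensorHom_assoc, ihA h.inl, ihB h.inr]

/-- Braiding reduces this to the left unit law, without a second induction. -/
theorem maskSplit_counit_right (A : Formula V) {U S : Mask A} (h : Split U U S) (hS : Void S) :
    maskSplit E A U U S h ≫ (𝟙 _ ⊗ₘ maskCounit E A S hS) ≫ (ρ_ _).hom = 𝟙 _ := by
  rw [← braiding_leftUnitor, BraidedCategory.braiding_naturality_assoc, ← Category.assoc,
    maskSplit_braiding, maskSplit_counit_left]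

end

section

open MonoidalCategory Formula Mask SEquiv

variable {V : Type u}

/-! ### The specific arrows of `S_≡` and their equations -/

namespace SEquiv

/-- The atomic formula `x ≡ y` as an object of `S_≡`. -/
abbrev atomic (x y : V) : SEquiv V := ⟨.eqv x y⟩

/-- Reflexivity, with an equality of variables as a hypothesis. -/
def reflHom {x y : V} (h : x = y) : 𝟙_ (SEquiv V) ⟶ atomic x y :=
  arrow (.r x) ≫ eqToHom (by rw [h])

def transHom (x y z : V) : atomic x y ⊗ atomic y z ⟶ atomic x z := arrow (.t x y z)

def symmHom (x y : V) : atomic x y ⟶ atomic y x := arrow (.s x y)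

theorem reflHom_rfl (x : V) : reflHom (rfl : x = x) = arrow (.r x) := Category.comp_id _

theorem reflHom_symmHom {x y : V} (h : x = y) :
    reflHom h ≫ symmHom x y = reflHom h.symm := by
  subst h
  rw [reflHom_rfl]
  exact Quotient.sound (ArrowTerm.Eqn.rs x)

theorem symmHom_symmHom (x y : V) : symmHom x y ≫ symmHom y x = 𝟙 _ :=
  Quotient.sound (ArrowTerm.Eqn.ss x y)

theorem reflHom_transHom_right (x y : V) :
    (𝟙 (atomic x y) ⊗ₘ reflHom rfl) ≫ transHom x y y = (ρ_ _).hom := by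
  rw [reflHom_rfl]
  exact Quotient.sound (ArrowTerm.Eqn.rtδ x y)

theorem reflHom_transHom_left (x y : V) :
    (reflHom rfl ⊗ₘ 𝟙 (atomic y x)) ≫ transHom y y x = (λ_ _).hom := by
  rw [reflHom_rfl]
  exact Quotient.sound (ArrowTerm.Eqn.rtσ x y)

theorem transHom_assoc (x y z w : V) :
    (transHom x y z ⊗ₘ 𝟙 (atomic z w)) ≫ transHom x z w =
      (α_ _ _ _).hom ≫ (𝟙 (atomic x y) ⊗ₘ transHom y z w) ≫ transHom x y w := by
  rw [← Iso.inv_comp_eq]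
  exact Quotient.sound ((ArrowTerm.Eqn.cat2 _ _ _).trans
    (ArrowTerm.Eqn.symm (ArrowTerm.Eqn.tb x y z w)))

theorem transHom_symmHom (x y z : V) :
    transHom x y z ≫ symmHom x z =
      (β_ _ _).hom ≫ (symmHom y z ⊗ₘ symmHom x y) ≫ transHom z y x :=
  Quotient.sound ((ArrowTerm.Eqn.ts x y z).trans
    (ArrowTerm.Eqn.symm (ArrowTerm.Eqn.cat2 _ _ _)))

end SEquiv

/-! ### Walks and normal forms -/

/-- The two variables of an atom: `false` stands for the left one and `true` for the right one. -/
def endVar : (A : Formula V) → At A → Bool → V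
  | .eqv x _, _, false => x
  | .eqv _ y, _, true => y
  | .and A _, .inl a, e => endVar A a e
  | .and _ B, .inr a, e => endVar B a e

/-- The product of the atoms in a set of atoms of a formula. -/
abbrev partObj (A : Formula V) (U : Mask A) : SEquiv V := maskObj atomic A U

abbrev partSplit {A : Formula V} {U S T : Mask A} (h : Split U S T) :
    partObj A U ⟶ partObj A S ⊗ partObj A T := maskSplit atomic A U S T h

abbrev partCounit {A : Formula V} {U : Mask A} (h : Void U) : partObj A U ⟶ 𝟙_ (SEquiv V) :=
  maskCounit atomic A U h

/-- An atom, read from left to right or from right to left. -/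
def orientAtom (x y : V) : (u e : Bool) → u = true →
    (atomObj atomic x y u ⟶ atomic (endVar (.eqv x y) () e) (endVar (.eqv x y) () !e))
  | true, false, _ => 𝟙 _
  | true, true, _ => symmHom x y

/-- The atom `a`, read from left to right or from right to left. -/
def orient : (A : Formula V) → (U : Mask A) → (a : At A) → (e : Bool) → Single U a →
    (partObj A U ⟶ atomic (endVar A a e) (endVar A a !e))
  | .eqv x y, U, _, e, h => orientAtom x y (U ()) e ((h ()).2 rfl)
  | .and A B, _, .inl a, e, h =>
    ((𝟙 _ ⊗ₘ maskCounit atomic B _ h.void_inr) ≫ (ρ_ _).hom) ≫ orient A _ a e h.inl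
  | .and A B, _, .inr a, e, h =>
    ((maskCounit atomic A _ h.void_inl ⊗ₘ 𝟙 _) ≫ (λ_ _).hom) ≫ orient B _ a e h.inr

/-- The atom `a`, read as an arrow from `x` to `y`. -/
def stepHom {A : Formula V} {U : Mask A} {a : At A} {e : Bool} (h : Single U a) {x y : V}
    (hx : endVar A a e = x) (hy : endVar A a (!e) = y) : partObj A U ⟶ atomic x y :=
  orient A U a e h ≫ eqToHom (by rw [hx, hy])

theorem stepHom_inl {A B : Formula V} {U : Mask (A.and B)} {a : At A} {e : Bool}
    (h : Single U (.inl a)) {x y : V} (hx : endVar A a e = x) (hy : endVar A a (!e) = y) :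
    stepHom h hx hy = ((𝟙 (partObj A U.fst) ⊗ₘ partCounit h.void_inr) ≫ (ρ_ _).hom) ≫
      stepHom h.inl hx hy :=
  Category.assoc _ _ _

theorem stepHom_inr {A B : Formula V} {U : Mask (A.and B)} {a : At B} {e : Bool}
    (h : Single U (.inr a)) {x y : V} (hx : endVar B a e = x) (hy : endVar B a (!e) = y) :
    stepHom h hx hy = ((partCounit h.void_inl ⊗ₘ 𝟙 (partObj B U.snd)) ≫ (λ_ _).hom) ≫
      stepHom h.inr hx hy :=
  Category.assoc _ _ _

/-- The equation (ss) is used when the atom was already reversed. The `eqToHom` is there because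
`!!e` reduces to `e` only once `e` is known; `stepHom_symmHom` has `hx'` for the same reason. -/
theorem orientAtom_symmHom (x y : V) (u e : Bool) (h : u = true) :
    orientAtom x y u e h ≫ symmHom _ _ =
      orientAtom x y u (!e) h ≫ eqToHom (by rw [Bool.not_not]) := by
  subst h
  cases e
  · exact (Category.id_comp _).trans (Category.comp_id _).symm
  · exact (symmHom_symmHom x y).trans (Category.comp_id _).symm

theorem stepHom_symmHom {A : Formula V} {U : Mask A} {a : At A} {e : Bool} (h : Single U a)
    {x y : V} (hx : endVar A a e = x) (hy : endVar A a (!e) = y)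
    (hx' : endVar A a (!!e) = x) :
    stepHom h hx hy ≫ symmHom x y = stepHom h hy hx' := by
  induction A with
  | top => exact a.elim
  | eqv x' y' =>
    subst hx hy
    exact (congrArg (· ≫ _) (Category.comp_id _)).trans (orientAtom_symmHom x' y' _ e _)
  | and A B ihA ihB =>
    rcases a with a | a
    · rw [stepHom_inl h hx hy, stepHom_inl h hy hx']
      exact (Category.assoc _ _ _).trans (congrArg _ (ihA h.inl hx hy hx'))
    · rw [stepHom_inr h hx hy, stepHom_inr h hy hx']
      exact (Category.assoc _ _ _).trans (congrArg _ (ihB h.inr hx hy hx'))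

/-- The arrow `f` from the product of the atoms in `U` to `x ≡ z` composes the atoms of a walk
from `x` to `z` one after the other, each in the given orientation. -/
def IsWalk (A : Formula V) : List (At A × Bool) → (U : Mask A) → (x z : V) →
    (partObj A U ⟶ atomic x z) → Prop
  | [], U, x, z, f => ∃ (hU : Void U) (h : x = z), f = partCounit hU ≫ reflHom h
  | (a, e) :: w, U, x, z, f => ∃ (S T : Mask A) (h : Split U S T) (hS : Single S a) (y : V)
      (hx : endVar A a e = x) (hy : endVar A a (!e) = y) (g : partObj A T ⟶ atomic y z),
      IsWalk A w T y z g ∧ f = partSplit h ≫ (stepHom hS hx hy ⊗ₘ g) ≫ transHom x y z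

/-- The arrow `f` from the product of the atoms in `U` to `B` makes a walk `d b` for every
atom `b` of `B`. -/
def IsNormal (A : Formula V) : (B : Formula V) → (At B → List (At A × Bool)) → (U : Mask A) →
    (partObj A U ⟶ (⟨B⟩ : SEquiv V)) → Prop
  | .top, _, U, f => ∃ h : Void U, f = partCounit h
  | .eqv x z, d, U, f => IsWalk A (d ()) U x z f
  | .and B C, d, U, f => ∃ (S T : Mask A) (h : Split U S T)
      (f₁ : partObj A S ⟶ (⟨B⟩ : SEquiv V)) (f₂ : partObj A T ⟶ (⟨C⟩ : SEquiv V)),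
      IsNormal A B (fun b => d (.inl b)) S f₁ ∧ IsNormal A C (fun b => d (.inr b)) T f₂ ∧
      f = partSplit h ≫ (f₁ ⊗ₘ f₂)

variable {A : Formula V}

/-- The list of a walk recovers the set of atoms it consumes. For a conjunction this is how the
walks determine the partition of the source. -/
theorem IsWalk.mem_iff {w : List (At A × Bool)} {U : Mask A} {x z : V}
    {f : partObj A U ⟶ atomic x z} (hf : IsWalk A w U x z f) (a : At A) :
    U a = true ↔ ∃ e, (a, e) ∈ w := by
  induction w generalizing U x with
  | nil => obtain ⟨hU, -⟩ := hf; simp [hU a]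
  | cons p w ih =>
    obtain ⟨b, e⟩ := p
    obtain ⟨S, T, h, hS, y, -, -, g, hg, -⟩ := hf
    rw [(h a).1, Bool.or_eq_true, hS a, ih hg]
    simp only [List.mem_cons, Prod.mk.injEq, exists_or, exists_and_left, exists_eq, and_true]

theorem IsNormal.mem_iff {B : Formula V} {d : At B → List (At A × Bool)} {U : Mask A}
    {f : partObj A U ⟶ (⟨B⟩ : SEquiv V)} (hf : IsNormal A B d U f) (a : At A) :
    U a = true ↔ ∃ b e, (a, e) ∈ d b := by
  induction B generalizing U with
  | top =>
    obtain ⟨hU, -⟩ := hf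
    simp only [hU a, Bool.false_eq_true, false_iff]
    rintro ⟨b, -⟩
    exact b.elim
  | eqv x z =>
    rw [IsWalk.mem_iff hf a]
    exact ⟨fun h => ⟨(), h⟩, fun ⟨_, h⟩ => h⟩
  | and B C ihB ihC =>
    obtain ⟨S, T, h, f₁, f₂, h₁, h₂, -⟩ := hf
    rw [(h a).1, Bool.or_eq_true, ihB h₁, ihC h₂]
    exact (Sum.exists (p := fun b => ∃ e, (a, e) ∈ d b)).symm

/-- A walk determines the arrow. -/
theorem IsWalk.unique {w : List (At A × Bool)} {U : Mask A} {x z : V}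
    {f f' : partObj A U ⟶ atomic x z} (hf : IsWalk A w U x z f) (hf' : IsWalk A w U x z f') :
    f = f' := by
  induction w generalizing U x with
  | nil =>
    obtain ⟨_, _, rfl⟩ := hf
    obtain ⟨_, _, rfl⟩ := hf'
    rfl
  | cons p w ih =>
    obtain ⟨b, e⟩ := p
    obtain ⟨S, T, h, hS, y, hx, hy, g, hg, rfl⟩ := hf
    obtain ⟨S', T', h', hS', y', hx', hy', g', hg', rfl⟩ := hf'
    -- The head of the list fixes the singleton, hence its complement, and the far end of the head
    -- fixes the intermediate variable.
    obtain rfl := hS.unique hS'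
    obtain rfl := h.eq_right h'
    subst hy hy'
    rw [ih hg hg']

/-- The walks determine the arrow. -/
theorem IsNormal.unique {B : Formula V} {d : At B → List (At A × Bool)} {U : Mask A}
    {f f' : partObj A U ⟶ (⟨B⟩ : SEquiv V)} (hf : IsNormal A B d U f)
    (hf' : IsNormal A B d U f') : f = f' := by
  induction B generalizing U with
  | top =>
    obtain ⟨_, rfl⟩ := hf
    obtain ⟨_, rfl⟩ := hf'
    rfl
  | eqv x z => exact IsWalk.unique hf hf'
  | and B C ihB ihC =>
    obtain ⟨S, T, h, f₁, f₂, h₁, h₂, rfl⟩ := hf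
    obtain ⟨S', T', h', f₁', f₂', h₁', h₂', rfl⟩ := hf'
    -- `S` consists of the atoms met by the walks that belong to the first conjunct.
    obtain rfl : S = S' := funext fun a => by
      rw [Bool.eq_iff_iff, h₁.mem_iff, h₁'.mem_iff]
    obtain rfl := h.eq_right h'
    rw [ihB h₁ h₁', ihC h₂ h₂']

/-! ### Closure of the normal forms under composition -/

/-- The unit law followed by an arbitrary `f`, which passes through the unitor by naturality; this
is the form in which it is applied to walks. -/
theorem partSplit_counit_left {D : SEquiv V} {U S : Mask A} (h : Split U S U) (hS : Void S)
    (f : partObj A U ⟶ D) :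
    partSplit h ≫ (partCounit hS ⊗ₘ f) ≫ (λ_ D).hom = f := by
  have h1 := maskSplit_counit_left atomic A h hS
  have h2 : (partCounit hS ⊗ₘ f) ≫ (λ_ D).hom =
      (partCounit hS ⊗ₘ 𝟙 _) ≫ (λ_ _).hom ≫ f := by
    rw [← leftUnitor_naturality, ← id_tensorHom, tensorHom_comp_tensorHom_assoc]
    simp
  rw [h2, ← Category.assoc, ← Category.assoc, Category.assoc (partSplit h), h1, Category.id_comp]

theorem partSplit_counit_right {D : SEquiv V} {U S : Mask A} (h : Split U U S) (hS : Void S)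
    (f : partObj A U ⟶ D) :
    partSplit h ≫ (f ⊗ₘ partCounit hS) ≫ (ρ_ D).hom = f := by
  have h1 := maskSplit_counit_right atomic A h hS
  have h2 : (f ⊗ₘ partCounit hS) ≫ (ρ_ D).hom =
      (𝟙 _ ⊗ₘ partCounit hS) ≫ (ρ_ _).hom ≫ f := by
    rw [← rightUnitor_naturality, ← tensorHom_id, tensorHom_comp_tensorHom_assoc]
    simp
  rw [h2, ← Category.assoc, ← Category.assoc, Category.assoc (partSplit h), h1, Category.id_comp]

theorem partSplit_braiding {D F : SEquiv V} {U S T : Mask A} (h : Split U S T)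
    (f : partObj A S ⟶ D) (g : partObj A T ⟶ F) :
    partSplit h ≫ (f ⊗ₘ g) ≫ (β_ D F).hom = partSplit h.symm ≫ (g ⊗ₘ f) := by
  rw [BraidedCategory.braiding_naturality, ← Category.assoc]
  exact congrArg (· ≫ _) (maskSplit_braiding atomic A h)

/-- Coassociativity followed by arrows on the three parts, via naturality of the associator. -/
theorem partSplit_assoc {D F G : SEquiv V} {U P Q R S T : Mask A} (h1 : Split U P R)
    (h2 : Split P S T) (h3 : Split U S Q) (h4 : Split Q T R) (f : partObj A S ⟶ D)
    (g : partObj A T ⟶ F) (k : partObj A R ⟶ G) :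
    partSplit h1 ≫ ((partSplit h2 ≫ (f ⊗ₘ g)) ⊗ₘ k) ≫ (α_ D F G).hom =
      partSplit h3 ≫ (f ⊗ₘ (partSplit h4 ≫ (g ⊗ₘ k))) := by
  have h := maskSplit_coassoc atomic A h1 h2 h3 h4
  have e1 : (partSplit h2 ≫ (f ⊗ₘ g)) ⊗ₘ k = (partSplit h2 ⊗ₘ 𝟙 _) ≫ ((f ⊗ₘ g) ⊗ₘ k) := by
    rw [tensorHom_comp_tensorHom, Category.id_comp]
  have e2 : f ⊗ₘ (partSplit h4 ≫ (g ⊗ₘ k)) = (𝟙 _ ⊗ₘ partSplit h4) ≫ (f ⊗ₘ (g ⊗ₘ k)) := by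
    rw [tensorHom_comp_tensorHom, Category.id_comp]
  rw [e1, e2, Category.assoc, associator_naturality, ← Category.assoc, ← Category.assoc,
    Category.assoc (partSplit h1), h, Category.assoc]

/-- Concatenation of walks. -/
theorem IsWalk.append {w w' : List (At A × Bool)} {U S T : Mask A} {x y z : V}
    {f : partObj A S ⟶ atomic x y} {g : partObj A T ⟶ atomic y z} (h : Split U S T)
    (hf : IsWalk A w S x y f) (hg : IsWalk A w' T y z g) :
    IsWalk A (w ++ w') U x z (partSplit h ≫ (f ⊗ₘ g) ≫ transHom x y z) := by
  induction w generalizing U S x with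
  | nil =>
    obtain ⟨hS, rfl, rfl⟩ := hf
    obtain rfl := h.eq_of_void_left hS
    have e : ((partCounit hS ≫ reflHom (rfl : x = x)) ⊗ₘ g) =
        (partCounit hS ⊗ₘ g) ≫ (reflHom (rfl : x = x) ⊗ₘ 𝟙 (atomic x z)) := by
      rw [tensorHom_comp_tensorHom, Category.comp_id]
    -- By (rtσ) the reflexivity of the empty walk is absorbed, and the unit law removes its empty
    -- set of atoms.
    rw [e, Category.assoc, reflHom_transHom_left, partSplit_counit_left]
    exact hg
  | cons p w ih =>
    obtain ⟨b, e⟩ := p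
    obtain ⟨S', T', h', hS', y', hx, hy, k, hk, rfl⟩ := hf
    obtain ⟨Q, h3, h4⟩ := h.assoc_right h'
    refine ⟨S', Q, h3, hS', y', hx, hy, _, ih h4 hk, ?_⟩
    have e1 : ((partSplit h' ≫ (stepHom hS' hx hy ⊗ₘ k) ≫ transHom x y' y) ⊗ₘ g) =
        ((partSplit h' ≫ (stepHom hS' hx hy ⊗ₘ k)) ⊗ₘ g) ≫
          (transHom x y' y ⊗ₘ 𝟙 (atomic y z)) := by
      rw [tensorHom_comp_tensorHom, Category.comp_id, Category.assoc]
    have e2 : (stepHom hS' hx hy ⊗ₘ (partSplit h4 ≫ (k ⊗ₘ g) ≫ transHom y' y z)) =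
        (stepHom hS' hx hy ⊗ₘ (partSplit h4 ≫ (k ⊗ₘ g))) ≫
          (𝟙 (atomic x y') ⊗ₘ transHom y' y z) := by
      rw [tensorHom_comp_tensorHom, Category.comp_id, Category.assoc]
    -- The equation (tb) rebrackets the transitivities, while coassociativity rebrackets the
    -- partition in the same way.
    rw [e1, e2, Category.assoc, Category.assoc, transHom_assoc,
      ← reassoc_of% partSplit_assoc h h' h3 h4]

end

/-! ### Reversal of walks and composition with arrow terms. -/

section

open MonoidalCategory Formula Mask SEquiv

variable {V : Type u} {A : Formula V}

/-- By definition a walk of one step still ends with the empty walk; (rtδ) absorbs its reflexivity.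
-/
theorem IsWalk.of_step {U : Mask A} {a : At A} {e : Bool} (h : Single U a) {x y : V}
    (hx : endVar A a e = x) (hy : endVar A a (!e) = y) :
    IsWalk A [(a, e)] U x y (stepHom h hx hy) := by
  have hT : Void (fun _ : At A => false) := fun _ => rfl
  have hU : Split U U (fun _ => false) := (split_of_void_left U hT).symm
  refine ⟨U, _, hU, h, y, hx, hy, _, ⟨hT, rfl, rfl⟩, ?_⟩
  have e : (stepHom h hx hy ⊗ₘ (partCounit hT ≫ reflHom (rfl : y = y))) =
      (stepHom h hx hy ⊗ₘ partCounit hT) ≫ (𝟙 (atomic x y) ⊗ₘ reflHom (rfl : y = y)) := by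
    rw [tensorHom_comp_tensorHom, Category.comp_id]
  rw [e, Category.assoc, reflHom_transHom_right, partSplit_counit_right]

/-- Reversal of walks. -/
theorem IsWalk.exists_symm {w : List (At A × Bool)} {U : Mask A} {x z : V}
    {f : partObj A U ⟶ atomic x z} (hf : IsWalk A w U x z f) :
    ∃ w', IsWalk A w' U z x (f ≫ symmHom x z) := by
  induction w generalizing U x with
  | nil =>
    obtain ⟨hU, h, rfl⟩ := hf
    exact ⟨[], hU, h.symm, by rw [Category.assoc, reflHom_symmHom]⟩
  | cons p w ih =>
    obtain ⟨a, e⟩ := p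
    obtain ⟨S, T, h, hS, y, hx, hy, g, hg, rfl⟩ := hf
    obtain ⟨w', hw'⟩ := ih hg
    have hx' : endVar A a (!!e) = x := by rw [Bool.not_not, hx]
    -- The list stays open until the last line, which makes it the reversed tail followed by the
    -- reversed head. The equation (ts) exchanges the two factors, and `partSplit_braiding`
    -- exchanges the two parts accordingly.
    apply Exists.intro
    rw [Category.assoc, Category.assoc, transHom_symmHom, ← Category.assoc _ (β_ _ _).hom,
      ← Category.assoc, partSplit_braiding, Category.assoc, tensorHom_comp_tensorHom_assoc,
      stepHom_symmHom hS hx hy hx']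
    exact hw'.append h.symm (IsWalk.of_step hS hy hx')

theorem IsNormal.tensor {B C : Formula V} {d : At B → List (At A × Bool)}
    {d' : At C → List (At A × Bool)} {U S T : Mask A} (h : Split U S T)
    {f : partObj A S ⟶ (⟨B⟩ : SEquiv V)} {g : partObj A T ⟶ (⟨C⟩ : SEquiv V)}
    (hf : IsNormal A B d S f) (hg : IsNormal A C d' T g) :
    IsNormal A (B.and C) (Sum.elim d d') U (partSplit h ≫ (f ⊗ₘ g)) :=
  ⟨S, T, h, f, g, hf, hg, rfl⟩

/-- The normal forms are closed under composition with arrow terms. -/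
theorem IsNormal.exists_comp {B C : Formula V} (k : ArrowTerm B C)
    {d : At B → List (At A × Bool)} {U : Mask A} {f : partObj A U ⟶ (⟨B⟩ : SEquiv V)}
    (hf : IsNormal A B d U f) : ∃ d', IsNormal A C d' U (f ≫ arrow k) := by
  induction k generalizing U with
  | one B => exact ⟨d, by rw [show f ≫ arrow (.one B) = f from Category.comp_id f]; exact hf⟩
  | bR B C D =>
    obtain ⟨S, Q, h3, f₁, _, h₁, ⟨T, R, h4, f₂, f₃, h₂, h₃, rfl⟩, rfl⟩ := hf
    -- Moving brackets in the target only regroups the partition; the walks stay the same.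
    obtain ⟨P, h1, h2⟩ := h3.assoc_left h4
    apply Exists.intro
    rw [← partSplit_assoc h1 h2, Category.assoc, Category.assoc,
      show arrow (.bR B C D) = (α_ (⟨B⟩ : SEquiv V) ⟨C⟩ ⟨D⟩).inv from rfl, Iso.hom_inv_id,
      Category.comp_id]
    exact (h₁.tensor h2 h₂).tensor h1 h₃
  | bL B C D =>
    obtain ⟨P, R, h1, _, f₃, ⟨S, T, h2, f₁, f₂, h₁, h₂, rfl⟩, h₃, rfl⟩ := hf
    obtain ⟨Q, h3, h4⟩ := h1.assoc_right h2
    apply Exists.intro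
    rw [Category.assoc, show arrow (.bL B C D) = (α_ (⟨B⟩ : SEquiv V) ⟨C⟩ ⟨D⟩).hom from rfl,
      partSplit_assoc h1 h2 h3 h4]
    exact h₁.tensor h3 (h₂.tensor h4 h₃)
  | δR B =>
    obtain ⟨S, T, h, f₁, _, h₁, ⟨hT, rfl⟩, rfl⟩ := hf
    obtain rfl := h.symm.eq_of_void_left hT
    apply Exists.intro
    rw [Category.assoc, show arrow (.δR B) = (ρ_ (⟨B⟩ : SEquiv V)).hom from rfl]
    erw [partSplit_counit_right]
    exact h₁
  | δL B =>
    have hT : Void (fun _ : At A => false) := fun _ => rfl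
    have hU : Split U U (fun _ => false) := (split_of_void_left U hT).symm
    refine ⟨Sum.elim d Empty.elim, U, _, hU, f, _, hf, ⟨hT, rfl⟩, ?_⟩
    rw [show arrow (.δL B) = (ρ_ (⟨B⟩ : SEquiv V)).inv from rfl, Iso.comp_inv_eq, Category.assoc]
    exact (partSplit_counit_right hU hT f).symm
  | σR B =>
    obtain ⟨S, T, h, _, f₂, ⟨hS, rfl⟩, h₂, rfl⟩ := hf
    obtain rfl := h.eq_of_void_left hS
    apply Exists.intro
    rw [Category.assoc, show arrow (.σR B) = (λ_ (⟨B⟩ : SEquiv V)).hom from rfl]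
    erw [partSplit_counit_left]
    exact h₂
  | σL B =>
    have hT : Void (fun _ : At A => false) := fun _ => rfl
    have hU : Split U (fun _ => false) U := split_of_void_left U hT
    refine ⟨Sum.elim Empty.elim d, _, U, hU, _, f, ⟨hT, rfl⟩, hf, ?_⟩
    rw [show arrow (.σL B) = (λ_ (⟨B⟩ : SEquiv V)).inv from rfl, Iso.comp_inv_eq, Category.assoc]
    exact (partSplit_counit_left hU hT f).symm
  | c B C =>
    obtain ⟨S, T, h, f₁, f₂, h₁, h₂, rfl⟩ := hf
    apply Exists.intro
    rw [Category.assoc, show arrow (.c B C) = (β_ (⟨B⟩ : SEquiv V) ⟨C⟩).hom from rfl,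
      partSplit_braiding]
    exact h₂.tensor h.symm h₁
  | r x =>
    obtain ⟨hU, rfl⟩ := hf
    exact ⟨fun _ => [], hU, rfl, by rw [reflHom_rfl]⟩
  | t x y z =>
    obtain ⟨S, T, h, f₁, f₂, h₁, h₂, rfl⟩ := hf
    -- Transitivity joins the walks of its two atoms into one.
    refine ⟨fun _ => d (.inl ()) ++ d (.inr ()), ?_⟩
    rw [Category.assoc]
    exact IsWalk.append h h₁ h₂
  | s x y =>
    obtain ⟨w, hw⟩ := IsWalk.exists_symm hf
    exact ⟨fun _ => w, hw⟩
  | conj k₁ k₂ ih₁ ih₂ =>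
    obtain ⟨S, T, h, f₁, f₂, h₁, h₂, rfl⟩ := hf
    obtain ⟨d₁, h₁'⟩ := ih₁ h₁
    obtain ⟨d₂, h₂'⟩ := ih₂ h₂
    apply Exists.intro
    rw [Category.assoc, show arrow (.conj k₁ k₂) = arrow k₁ ⊗ₘ arrow k₂ from rfl,
      tensorHom_comp_tensorHom]
    exact h₁'.tensor h h₂'
  | comp k₂ k₁ ih₂ ih₁ =>
    obtain ⟨d₁, h₁⟩ := ih₁ hf
    obtain ⟨d₂, h₂⟩ := ih₂ h₁
    refine ⟨d₂, ?_⟩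
    rw [Category.assoc] at h₂
    exact h₂

/-! ### The normal form of the identity -/

/-! ### Deleting units before or after splitting. -/

section

variable {C : Type*} [Category* C] [MonoidalCategory C]

/-- Erasing both factors may be done one factor at a time; the case used is a conjunction with an
unselected conjunct. -/
theorem tensor_counit_eq_right {X Y : C} (e : X ⟶ 𝟙_ C) (e' : Y ⟶ 𝟙_ C) :
    (e ⊗ₘ e') ≫ (λ_ (𝟙_ C)).hom = ((𝟙 X ⊗ₘ e') ≫ (ρ_ X).hom) ≫ e := by
  rw [Category.assoc, ← rightUnitor_naturality, ← tensorHom_id, tensorHom_comp_tensorHom_assoc,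
    Category.id_comp, Category.comp_id, unitors_equal]

theorem tensor_counit_eq_left {X Y : C} (e : X ⟶ 𝟙_ C) (e' : Y ⟶ 𝟙_ C) :
    (e ⊗ₘ e') ≫ (λ_ (𝟙_ C)).hom = ((e ⊗ₘ 𝟙 Y) ≫ (λ_ Y).hom) ≫ e' := by
  rw [Category.assoc, ← leftUnitor_naturality, ← id_tensorHom, tensorHom_comp_tensorHom_assoc,
    Category.id_comp, Category.comp_id]

variable [BraidedCategory C]

/-- If the factor `Z` is erasable compatibly with its splitting, erasing it commutes with splitting
the whole. This makes the projections `inlHom` respect partitions. -/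
theorem tensorμ_comp_rightUnitor {X X₁ X₂ Z Z₁ Z₂ : C} (s : X ⟶ X₁ ⊗ X₂) (t : Z ⟶ Z₁ ⊗ Z₂)
    {e : Z ⟶ 𝟙_ C} {e₁ : Z₁ ⟶ 𝟙_ C} {e₂ : Z₂ ⟶ 𝟙_ C}
    (h : t ≫ (e₁ ⊗ₘ e₂) = e ≫ (λ_ (𝟙_ C)).inv) :
    ((s ⊗ₘ t) ≫ tensorμ _ _ _ _) ≫
        (((𝟙 X₁ ⊗ₘ e₁) ≫ (ρ_ X₁).hom) ⊗ₘ ((𝟙 X₂ ⊗ₘ e₂) ≫ (ρ_ X₂).hom)) =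
      ((𝟙 X ⊗ₘ e) ≫ (ρ_ X).hom) ≫ s := by
  rw [← tensorHom_comp_tensorHom, Category.assoc, ← reassoc_of% tensorμ_natural,
    tensorHom_comp_tensorHom_assoc, id_tensorHom_id, Category.comp_id, h,
    Category.assoc, ← rightUnitor_naturality, tensor_right_unitality, ← id_tensorHom,
    ← tensorHom_id, tensorHom_comp_tensorHom_assoc, tensorHom_comp_tensorHom_assoc]
  simp only [Category.id_comp, Category.comp_id]

theorem tensorμ_comp_leftUnitor {X X₁ X₂ Z Z₁ Z₂ : C} (t : Z ⟶ Z₁ ⊗ Z₂) (s : X ⟶ X₁ ⊗ X₂)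
    {e : Z ⟶ 𝟙_ C} {e₁ : Z₁ ⟶ 𝟙_ C} {e₂ : Z₂ ⟶ 𝟙_ C}
    (h : t ≫ (e₁ ⊗ₘ e₂) = e ≫ (λ_ (𝟙_ C)).inv) :
    ((t ⊗ₘ s) ≫ tensorμ _ _ _ _) ≫
        (((e₁ ⊗ₘ 𝟙 X₁) ≫ (λ_ X₁).hom) ⊗ₘ ((e₂ ⊗ₘ 𝟙 X₂) ≫ (λ_ X₂).hom)) =
      ((e ⊗ₘ 𝟙 X) ≫ (λ_ X).hom) ≫ s := by
  rw [← tensorHom_comp_tensorHom, Category.assoc, ← reassoc_of% tensorμ_natural,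
    tensorHom_comp_tensorHom_assoc, id_tensorHom_id, Category.comp_id, h,
    Category.assoc, ← leftUnitor_naturality, tensor_left_unitality, ← id_tensorHom,
    ← tensorHom_id, tensorHom_comp_tensorHom_assoc, tensorHom_comp_tensorHom_assoc]
  simp only [Category.id_comp, Category.comp_id]

/-- The crossing in the middle exchanges two units, so it is made of unitors. -/
theorem tensorμ_unit_unit (X Y : C) :
    tensorμ X (𝟙_ C) (𝟙_ C) Y ≫ ((ρ_ X).hom ⊗ₘ (λ_ Y).hom) = (ρ_ X).hom ⊗ₘ (λ_ Y).hom := by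
  simp only [tensorμ, braiding_tensorUnit_left]
  monoidal

/-- After erasure only `tensorμ` with units in the middle remains, and the hypotheses cancel factor
by factor. -/
theorem tensorμ_comp_unitors {X X' Y Y' : C} {s : X ⟶ X ⊗ X'} {t : Y ⟶ Y' ⊗ Y}
    {e : X' ⟶ 𝟙_ C} {e' : Y' ⟶ 𝟙_ C} (hs : s ≫ (𝟙 X ⊗ₘ e) ≫ (ρ_ X).hom = 𝟙 X)
    (ht : t ≫ (e' ⊗ₘ 𝟙 Y) ≫ (λ_ Y).hom = 𝟙 Y) :
    ((s ⊗ₘ t) ≫ tensorμ _ _ _ _) ≫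
      (((𝟙 X ⊗ₘ e') ≫ (ρ_ X).hom) ⊗ₘ ((e ⊗ₘ 𝟙 Y) ≫ (λ_ Y).hom)) = 𝟙 (X ⊗ Y) := by
  rw [← tensorHom_comp_tensorHom, Category.assoc, ← reassoc_of% tensorμ_natural,
    tensorμ_unit_unit, tensorHom_comp_tensorHom_assoc, tensorHom_comp_tensorHom,
    Category.assoc, Category.assoc, hs, ht, id_tensorHom_id]

end

/-! ### Normal forms of a conjunct, transported to the conjunction. -/

variable {B : Formula V}

/-- A set of atoms of the first conjunct as a set of atoms of the conjunction. -/
abbrev Mask.inl (B : Formula V) (U : Mask A) : Mask (A.and B) := Sum.elim U fun _ => false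

/-- A set of atoms of the second conjunct as a set of atoms of the conjunction. -/
abbrev Mask.inr (A : Formula V) {B : Formula V} (U : Mask B) : Mask (A.and B) :=
  Sum.elim (fun _ => false) U

theorem Mask.Void.const : Void (fun _ : At A => false) := fun _ => rfl

/-- The projection that deletes the units in the places of the atoms of `B`. -/
def inlHom (B : Formula V) (U : Mask A) : partObj (A.and B) (Mask.inl B U) ⟶ partObj A U :=
  (𝟙 (partObj A U) ⊗ₘ maskCounit atomic B _ Void.const) ≫ (ρ_ (partObj A U)).hom

/-- The projection that deletes the units in the places of the atoms of `A`. -/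
def inrHom (A : Formula V) {B : Formula V} (U : Mask B) :
    partObj (A.and B) (Mask.inr A U) ⟶ partObj B U :=
  (maskCounit atomic A _ Void.const ⊗ₘ 𝟙 (partObj B U)) ≫ (λ_ (partObj B U)).hom

theorem Mask.Split.of_inl (B : Formula V) {U S T : Mask A} (h : Split U S T) :
    Split (Mask.inl B U) (Mask.inl B S) (Mask.inl B T) := by
  rintro (a | a)
  · exact h a
  · exact ⟨rfl, rfl⟩

theorem Mask.Split.of_inr (A : Formula V) {B : Formula V} {U S T : Mask B} (h : Split U S T) :
    Split (Mask.inr A U) (Mask.inr A S) (Mask.inr A T) := by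
  rintro (a | a)
  · exact ⟨rfl, rfl⟩
  · exact h a

theorem Mask.Void.of_inl (B : Formula V) {U : Mask A} (h : Void U) : Void (Mask.inl B U) := by
  rintro (a | a)
  · exact h a
  · rfl

theorem Mask.Void.of_inr (A : Formula V) {B : Formula V} {U : Mask B} (h : Void U) :
    Void (Mask.inr A U) := by
  rintro (a | a)
  · rfl
  · exact h a

theorem Mask.Single.of_inl (B : Formula V) {U : Mask A} {a : At A} (h : Single U a) :
    Single (Mask.inl B U) (.inl a) := by
  rintro (b | b)
  · exact (h b).trans Sum.inl_injective.eq_iff.symm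
  · exact ⟨fun h => absurd h Bool.false_ne_true, fun h => absurd h Sum.inr_ne_inl⟩

theorem Mask.Single.of_inr (A : Formula V) {B : Formula V} {U : Mask B} {a : At B}
    (h : Single U a) : Single (Mask.inr A U) (.inr a) := by
  rintro (b | b)
  · exact ⟨fun h => absurd h Bool.false_ne_true, fun h => absurd h Sum.inl_ne_inr⟩
  · exact (h b).trans Sum.inr_injective.eq_iff.symm

/-- A void `S` forces `U = T`, and the unit law applies. This supplies the compatibility hypothesis
of `tensorμ_comp_rightUnitor` and `tensorμ_comp_leftUnitor`. -/
theorem partSplit_counit_counit {U S T : Mask A} (h : Split U S T) (hU : Void U) (hS : Void S)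
    (hT : Void T) :
    partSplit h ≫ (partCounit hS ⊗ₘ partCounit hT) = partCounit hU ≫ (λ_ _).inv := by
  obtain rfl := h.eq_of_void_left hS
  rw [Iso.eq_comp_inv, Category.assoc, partSplit_counit_left]

theorem partSplit_inlHom (B : Formula V) {U S T : Mask A} (h : Split U S T) :
    partSplit (h.of_inl B) ≫ (inlHom B S ⊗ₘ inlHom B T) = inlHom B U ≫ partSplit h :=
  tensorμ_comp_rightUnitor _ _ (partSplit_counit_counit _ _ _ _)

theorem partSplit_inrHom (A : Formula V) {B : Formula V} {U S T : Mask B} (h : Split U S T) :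
    partSplit (h.of_inr A) ≫ (inrHom A S ⊗ₘ inrHom A T) = inrHom A U ≫ partSplit h :=
  tensorμ_comp_leftUnitor _ _ (partSplit_counit_counit _ _ _ _)

theorem inlHom_counit (B : Formula V) {U : Mask A} (h : Void U) :
    partCounit (h.of_inl B) = inlHom B U ≫ partCounit h :=
  tensor_counit_eq_right _ _

theorem inrHom_counit (A : Formula V) {B : Formula V} {U : Mask B} (h : Void U) :
    partCounit (h.of_inr A) = inrHom A U ≫ partCounit h :=
  tensor_counit_eq_left _ _

/-- Each atom `a` of the list is renamed `.inl a`; projections commute with splitting, counits and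
steps, so they move through the walk to its front. -/
theorem IsWalk.exists_inl (B : Formula V) {w : List (At A × Bool)} {U : Mask A} {x z : V}
    {f : partObj A U ⟶ atomic x z} (hf : IsWalk A w U x z f) :
    ∃ w', IsWalk (A.and B) w' (Mask.inl B U) x z (inlHom B U ≫ f) := by
  induction w generalizing U x with
  | nil =>
    obtain ⟨hU, h, rfl⟩ := hf
    exact ⟨[], hU.of_inl B, h, by rw [inlHom_counit, Category.assoc]⟩
  | cons p w ih =>
    obtain ⟨a, e⟩ := p
    obtain ⟨S, T, h, hS, y, hx, hy, g, hg, rfl⟩ := hf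
    obtain ⟨w', hw'⟩ := ih hg
    refine ⟨(.inl a, e) :: w', _, _, h.of_inl B, hS.of_inl B, y, hx, hy, _, hw', ?_⟩
    have e : stepHom (hS.of_inl B) hx hy = inlHom B S ≫ stepHom hS hx hy := stepHom_inl _ _ _
    rw [e, ← tensorHom_comp_tensorHom, Category.assoc, ← Category.assoc, ← Category.assoc,
      ← partSplit_inlHom]
    simp only [Category.assoc]

theorem IsWalk.exists_inr (A : Formula V) {B : Formula V} {w : List (At B × Bool)} {U : Mask B}
    {x z : V} {f : partObj B U ⟶ atomic x z} (hf : IsWalk B w U x z f) :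
    ∃ w', IsWalk (A.and B) w' (Mask.inr A U) x z (inrHom A U ≫ f) := by
  induction w generalizing U x with
  | nil =>
    obtain ⟨hU, h, rfl⟩ := hf
    exact ⟨[], hU.of_inr A, h, by rw [inrHom_counit, Category.assoc]⟩
  | cons p w ih =>
    obtain ⟨a, e⟩ := p
    obtain ⟨S, T, h, hS, y, hx, hy, g, hg, rfl⟩ := hf
    obtain ⟨w', hw'⟩ := ih hg
    refine ⟨(.inr a, e) :: w', _, _, h.of_inr A, hS.of_inr A, y, hx, hy, _, hw', ?_⟩
    have e : stepHom (hS.of_inr A) hx hy = inrHom A S ≫ stepHom hS hx hy := stepHom_inr _ _ _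
    rw [e, ← tensorHom_comp_tensorHom, Category.assoc, ← Category.assoc, ← Category.assoc,
      ← partSplit_inrHom]
    simp only [Category.assoc]

theorem IsNormal.exists_inl (B : Formula V) {D : Formula V} {d : At D → List (At A × Bool)}
    {U : Mask A} {f : partObj A U ⟶ (⟨D⟩ : SEquiv V)} (hf : IsNormal A D d U f) :
    ∃ d', IsNormal (A.and B) D d' (Mask.inl B U) (inlHom B U ≫ f) := by
  induction D generalizing U with
  | top =>
    obtain ⟨hU, rfl⟩ := hf
    exact ⟨Empty.elim, hU.of_inl B, (inlHom_counit B hU).symm⟩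
  | eqv x z =>
    obtain ⟨w, hw⟩ := IsWalk.exists_inl B hf
    exact ⟨fun _ => w, hw⟩
  | and D F ihD ihF =>
    obtain ⟨S, T, h, f₁, f₂, h₁, h₂, rfl⟩ := hf
    obtain ⟨d₁, h₁⟩ := ihD h₁
    obtain ⟨d₂, h₂⟩ := ihF h₂
    apply Exists.intro
    rw [← Category.assoc, ← partSplit_inlHom, Category.assoc, tensorHom_comp_tensorHom]
    exact h₁.tensor (h.of_inl B) h₂

theorem IsNormal.exists_inr (A : Formula V) {B D : Formula V} {d : At D → List (At B × Bool)}
    {U : Mask B} {f : partObj B U ⟶ (⟨D⟩ : SEquiv V)} (hf : IsNormal B D d U f) :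
    ∃ d', IsNormal (A.and B) D d' (Mask.inr A U) (inrHom A U ≫ f) := by
  induction D generalizing U with
  | top =>
    obtain ⟨hU, rfl⟩ := hf
    exact ⟨Empty.elim, hU.of_inr A, (inrHom_counit A hU).symm⟩
  | eqv x z =>
    obtain ⟨w, hw⟩ := IsWalk.exists_inr A hf
    exact ⟨fun _ => w, hw⟩
  | and D F ihD ihF =>
    obtain ⟨S, T, h, f₁, f₂, h₁, h₂, rfl⟩ := hf
    obtain ⟨d₁, h₁⟩ := ihD h₁
    obtain ⟨d₂, h₂⟩ := ihF h₂
    apply Exists.intro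
    rw [← Category.assoc, ← partSplit_inrHom, Category.assoc, tensorHom_comp_tensorHom]
    exact h₁.tensor (h.of_inr A) h₂

/-! ### The formula as the product of all its atoms. -/

/-- An atom that is selected. -/
def atomIso (x y : V) : (u : Bool) → u = true → (atomObj atomic x y u ≅ atomic x y)
  | true, _ => Iso.refl _

theorem atomIso_hom (x y : V) (u : Bool) (h : u = true) :
    (atomIso x y u h).hom = orientAtom x y u false h := by
  subst h
  rfl

/-- The product of all atoms of a formula is the formula. -/
def fullIso : (A : Formula V) → (U : Mask A) → Full U → (partObj A U ≅ (⟨A⟩ : SEquiv V))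
  | .top, _, _ => Iso.refl _
  | .eqv x y, U, h => atomIso x y (U ()) (h ())
  | .and A B, U, h =>
    (fullIso A U.fst h.inl ⊗ᵢ fullIso B U.snd h.inr : _ ≅ (⟨A⟩ ⊗ ⟨B⟩ : SEquiv V))

theorem Mask.split_fst_snd (U : Mask (A.and B)) :
    Split U (Mask.inl B U.fst) (Mask.inr A U.snd) := by
  rintro (a | a) <;> simp

theorem partSplit_fst_snd (U : Mask (A.and B)) :
    partSplit U.split_fst_snd ≫ (inlHom B U.fst ⊗ₘ inrHom A U.snd) = 𝟙 _ :=
  tensorμ_comp_unitors (partSplit_counit_right _ _ (𝟙 _)) (partSplit_counit_left _ _ (𝟙 _))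

/-- This isomorphism stands in for the identity of `A`. Each atom is walked once, from left to
right; for a conjunction the two families are placed side by side, and `partSplit_fst_snd` shows
that splitting off the conjuncts costs nothing. -/
theorem exists_isNormal_fullIso (A : Formula V) (U : Mask A) (h : Full U) :
    ∃ d, IsNormal A A d U (fullIso A U h).hom := by
  induction A with
  | top => exact ⟨Empty.elim, fun a => a.elim, rfl⟩
  | eqv x y =>
    have hU : Single U () := fun b => ⟨fun _ => rfl, fun _ => h b⟩
    refine ⟨fun _ => [((), false)], ?_⟩
    have e : (fullIso (.eqv x y) U h).hom = stepHom (e := false) hU rfl rfl :=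
      (atomIso_hom x y _ _).trans (Category.comp_id _).symm
    rw [e]
    exact IsWalk.of_step hU rfl rfl
  | and A B ihA ihB =>
    obtain ⟨d₁, h₁⟩ := ihA _ h.inl
    obtain ⟨d₂, h₂⟩ := ihB _ h.inr
    obtain ⟨d₁, h₁⟩ := h₁.exists_inl B
    obtain ⟨d₂, h₂⟩ := h₂.exists_inr A
    apply Exists.intro
    have e := h₁.tensor U.split_fst_snd h₂
    rw [← tensorHom_comp_tensorHom, ← Category.assoc, partSplit_fst_snd] at e
    -- The isomorphism for a conjunction is by definition the tensor product of the two
    -- isomorphisms.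
    exact (Category.id_comp _ : _ = (fullIso (A.and B) U h).hom) ▸ e

end

section

open MonoidalCategory Formula Mask SEquiv

variable {V : Type u}

/-! ### The diagrams of the arrows of `S_≡` -/

namespace Diagram

variable {X Y Z X' Y' : Type}

theorem eqvGen_upper {D : Diagram X Y} (E : Diagram Y Z) {a b : X ⊕ Y} (h : D.rel a b) :
    Relation.EqvGen (Link D.rel E.rel) (Sum.map id Sum.inl a) (Sum.map id Sum.inl b) :=
  .rel _ _ (.upper h)

theorem eqvGen_lower (D : Diagram X Y) {E : Diagram Y Z} {a b : Y ⊕ Z} (h : E.rel a b) :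
    Relation.EqvGen (Link D.rel E.rel) (Sum.inr a) (Sum.inr b) :=
  .rel _ _ (.lower h)

theorem tensor_rel_inl {D : Diagram X Y} (E : Diagram X' Y') {a b : X ⊕ Y} (h : D.rel a b) :
    (tensor D E).rel (Sum.map Sum.inl Sum.inl a) (Sum.map Sum.inl Sum.inl b) := by
  rcases a with a | a <;> rcases b with b | b <;> exact .inl h

theorem tensor_rel_inr (D : Diagram X Y) {E : Diagram X' Y'} {a b : X' ⊕ Y'} (h : E.rel a b) :
    (tensor D E).rel (Sum.map Sum.inr Sum.inr a) (Sum.map Sum.inr Sum.inr b) := by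
  rcases a with a | a <;> rcases b with b | b <;> exact .inr h

end Diagram

namespace SEquiv

/-- The diagram of an arrow of `S_≡`. -/
def diag {X Y : SEquiv V} (f : X ⟶ Y) : Diagram (Occ X.formula) (Occ Y.formula) :=
  Quotient.lift ArrowTerm.diagram (fun _ _ h => ArrowTerm.diagram_eq h) f

theorem diag_comp {X Y Z : SEquiv V} (f : X ⟶ Y) (g : Y ⟶ Z) :
    diag (f ≫ g) = (diag f).comp (diag g) := by
  rcases f with ⟨f⟩; rcases g with ⟨g⟩
  rfl

theorem diag_tensor {X Y X' Y' : SEquiv V} (f : X ⟶ Y) (g : X' ⟶ Y') :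
    diag (f ⊗ₘ g) = Diagram.tensor (diag f) (diag g) := by
  rcases f with ⟨f⟩; rcases g with ⟨g⟩
  rfl

/-! ### Labels carried along the edges of structural arrows. -/

/-- The points at the bottom are joined to points at the top that carry the same labels. -/
def Follows {X Y : SEquiv V} {L : Type} (f : X ⟶ Y) (l : Occ X.formula → L)
    (l' : Occ Y.formula → L) : Prop :=
  ∀ q, ∃ p, (diag f).rel (.inl p) (.inr q) ∧ l p = l' q

variable {X Y Z X' Y' : SEquiv V} {L : Type}

/-- Two vertical edges glue to a path. Splittings, projections and steps all have such diagrams, so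
atom and side of each occurrence can be followed through them. -/
theorem Follows.comp {f : X ⟶ Y} {g : Y ⟶ Z} {l : Occ X.formula → L} {l' : Occ Y.formula → L}
    {l'' : Occ Z.formula → L} (hf : Follows f l l') (hg : Follows g l' l'') :
    Follows (f ≫ g) l l'' := by
  intro r
  obtain ⟨q, hq, e⟩ := hg r
  obtain ⟨p, hp, e'⟩ := hf q
  refine ⟨p, ?_, e'.trans e⟩
  rw [diag_comp]
  exact .trans _ _ _ (.rel _ _ (.upper hp)) (.rel _ _ (.lower hq))

theorem Follows.tensor {f : X ⟶ Y} {g : X' ⟶ Y'} {l : Occ X.formula → L}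
    {l' : Occ Y.formula → L} {k : Occ X'.formula → L} {k' : Occ Y'.formula → L}
    (hf : Follows f l l') (hg : Follows g k k') :
    Follows (f ⊗ₘ g) (Sum.elim l k) (Sum.elim l' k') := by
  rintro (q | q)
  · obtain ⟨p, hp, e⟩ := hf q
    refine ⟨.inl p, ?_, e⟩
    rw [diag_tensor]
    exact .inl hp
  · obtain ⟨p, hp, e⟩ := hg q
    refine ⟨.inr p, ?_, e⟩
    rw [diag_tensor]
    exact .inr hp

theorem Follows.map {L' : Type} {f : X ⟶ Y} {l : Occ X.formula → L}
    {l' : Occ Y.formula → L} (h : Follows f l l') (F : L → L') :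
    Follows f (fun p => F (l p)) (fun q => F (l' q)) := fun q => by
  obtain ⟨p, hp, e⟩ := h q
  exact ⟨p, hp, congrArg F e⟩

theorem Follows.congr {f : X ⟶ Y} {l : Occ X.formula → L}
    {l₁ l₂ : Occ Y.formula → L} (h : Follows f l l₁) (e : ∀ q, l₁ q = l₂ q) :
    Follows f l l₂ := (funext e : l₁ = l₂) ▸ h

theorem follows_of_equiv {f : X ⟶ Y} {l : Occ X.formula → L} {l' : Occ Y.formula → L}
    (e : Occ X.formula ≃ Occ Y.formula) (he : diag f = Diagram.ofEquiv e)
    (hl : ∀ p, l p = l' (e p)) : Follows f l l' := by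
  intro q
  refine ⟨e.symm q, ?_, by rw [hl, e.apply_symm_apply]⟩
  rw [he]
  exact e.apply_symm_apply q

theorem follows_id (l : Occ X.formula → L) : Follows (𝟙 X) l l :=
  follows_of_equiv (Equiv.refl _) rfl fun _ => rfl

theorem follows_unit (f : X ⟶ 𝟙_ (SEquiv V)) (l : Occ X.formula → L) :
    Follows f l Fin.elim0 := fun q => Fin.elim0 q

theorem follows_associator_hom (l : Occ X.formula → L) (k : Occ Y.formula → L)
    (m : Occ Z.formula → L) :
    Follows (α_ X Y Z).hom (Sum.elim (Sum.elim l k) m) (Sum.elim l (Sum.elim k m)) :=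
  follows_of_equiv (Equiv.sumAssoc _ _ _) rfl (by rintro ((_ | _) | _) <;> rfl)

theorem follows_associator_inv (l : Occ X.formula → L) (k : Occ Y.formula → L)
    (m : Occ Z.formula → L) :
    Follows (α_ X Y Z).inv (Sum.elim l (Sum.elim k m)) (Sum.elim (Sum.elim l k) m) :=
  follows_of_equiv (Equiv.sumAssoc _ _ _).symm rfl (by rintro (_ | _ | _) <;> rfl)

theorem follows_braiding (l : Occ X.formula → L) (k : Occ Y.formula → L) :
    Follows (β_ X Y).hom (Sum.elim l k) (Sum.elim k l) :=
  follows_of_equiv (Equiv.sumComm _ _) rfl (by rintro (_ | _) <;> rfl)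

theorem follows_leftUnitor_hom (l : Occ X.formula → L) :
    Follows (λ_ X).hom (Sum.elim Fin.elim0 l) l :=
  follows_of_equiv (Equiv.emptySum (Fin 0) _) rfl (by
    rintro (p | _)
    · exact Fin.elim0 p
    · rfl)

theorem follows_rightUnitor_hom (l : Occ X.formula → L) :
    Follows (ρ_ X).hom (Sum.elim l Fin.elim0) l :=
  follows_of_equiv (Equiv.sumEmpty _ (Fin 0)) rfl (by
    rintro (_ | p)
    · rfl
    · exact Fin.elim0 p)

theorem follows_leftUnitor_inv (l : Occ X.formula → L) (k : Fin 0 → L) :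
    Follows (λ_ X).inv l (Sum.elim k l) :=
  follows_of_equiv (Equiv.emptySum (Fin 0) _).symm rfl fun _ => rfl

theorem follows_rightUnitor_inv (l : Occ X.formula → L) (k : Fin 0 → L) :
    Follows (ρ_ X).inv l (Sum.elim l k) :=
  follows_of_equiv (Equiv.sumEmpty _ (Fin 0)).symm rfl fun _ => rfl

theorem follows_tensorμ (l : Occ X.formula → L) (k : Occ Y.formula → L)
    (l' : Occ X'.formula → L) (k' : Occ Y'.formula → L) :
    Follows (tensorμ X Y X' Y') (Sum.elim (Sum.elim l k) (Sum.elim l' k'))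
      (Sum.elim (Sum.elim l l') (Sum.elim k k')) := by
  simp only [tensorμ, ← id_tensorHom, ← tensorHom_id]
  exact (follows_associator_hom _ _ _).comp <|
    ((follows_id _).tensor (follows_associator_inv _ _ _)).comp <|
    ((follows_id _).tensor ((follows_braiding _ _).tensor (follows_id _))).comp <|
    ((follows_id _).tensor (follows_associator_hom _ _ _)).comp (follows_associator_inv _ _ _)

theorem follows_symmHom (x y : V) (l : Fin 2 → L) :
    Follows (symmHom x y) l (fun i : Fin 2 => l ((Equiv.swap 0 1 : Equiv.Perm (Fin 2)) i)) :=
  follows_of_equiv (X := atomic x y) (Y := atomic y x) (Equiv.swap 0 1 : Equiv.Perm (Fin 2)) rfl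
    fun p => congrArg l (DFunLike.congr_fun (Equiv.swap_swap (0 : Fin 2) 1) p).symm

/-! ### Edges expressed through labels, and their behaviour under composition. -/

/-- The points with labels `P` and `Q` are the ends of an edge. The points at the bottom are
their own labels. -/
def IsEdge (l : Occ X.formula → L) (f : X ⟶ Y) (P Q : L ⊕ Occ Y.formula) : Prop :=
  ∃ p q, p ≠ q ∧ (diag f).rel p q ∧ Sum.map l id p = P ∧ Sum.map l id q = Q

theorem IsEdge.right_unique {l : Occ X.formula → L} (hl : Function.Injective l) {f : X ⟶ Y}
    {P Q Q' : L ⊕ Occ Y.formula} (h : IsEdge l f P Q) (h' : IsEdge l f P Q') : Q = Q' := by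
  obtain ⟨p, q, hpq, hr, rfl, rfl⟩ := h
  obtain ⟨p', q', hpq', hr', e, rfl⟩ := h'
  obtain rfl := hl.sumMap Function.injective_id e
  rw [((diag f).pair p').unique ⟨hpq.symm, hr⟩ ⟨hpq'.symm, hr'⟩]

/-- An edge of `g` is prolonged upwards from each of its ends in the middle. Labels are preserved by
`Follows`, so the labelled edge is unchanged. -/
theorem IsEdge.comp_left {f : X ⟶ Y} {g : Y ⟶ Z} {l : Occ X.formula → L}
    {l' : Occ Y.formula → L} (hf : Follows f l l') {P Q : L ⊕ Occ Z.formula}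
    (h : IsEdge l' g P Q) : IsEdge l (f ≫ g) P Q := by
  choose F hF hl using hf
  -- Two middle points over the same top point would lie in one class with it, a third element too
  -- many.
  have hFi : Function.Injective F := fun y y' e => by
    have h' := hF y'
    rw [← e] at h'
    exact Sum.inr_injective (((diag f).pair _).unique ⟨Sum.inr_ne_inl, hF y⟩ ⟨Sum.inr_ne_inl, h'⟩)
  have hlink : ∀ p : Occ Y.formula ⊕ Occ Z.formula,
      Relation.EqvGen (Diagram.Link (diag f).rel (diag g).rel)
        (Sum.map id Sum.inr (Sum.map F id p)) (.inr p) := by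
    rintro (y | z)
    · exact .rel _ _ (.upper (hF y))
    · exact .refl _
  have hmap : ∀ p : Occ Y.formula ⊕ Occ Z.formula,
      Sum.map l id (Sum.map F id p) = Sum.map l' id p := by
    rintro (y | z)
    · exact congrArg Sum.inl (hl y)
    · rfl
  obtain ⟨p, q, hpq, hr, rfl, rfl⟩ := h
  refine ⟨Sum.map F id p, Sum.map F id q,
    (hFi.sumMap Function.injective_id).ne hpq, ?_, hmap p, hmap q⟩
  rw [diag_comp]
  exact .trans _ _ _ (hlink p) (.trans _ _ _ (.rel _ _ (.lower hr)) (.symm _ _ (hlink q)))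

theorem IsEdge.tensor_left {f : X ⟶ Y} (g : X' ⟶ Y') {l : Occ X.formula → L}
    (k : Occ X'.formula → L) {P Q : L ⊕ Occ Y.formula} (h : IsEdge l f P Q) :
    IsEdge (Sum.elim l k) (f ⊗ₘ g) (Sum.map id Sum.inl P) (Sum.map id Sum.inl Q) := by
  obtain ⟨p, q, hpq, hr, rfl, rfl⟩ := h
  refine ⟨Sum.map .inl .inl p, Sum.map .inl .inl q,
    (Sum.inl_injective.sumMap Sum.inl_injective).ne hpq, ?_, ?_, ?_⟩
  · rw [diag_tensor]
    exact Diagram.tensor_rel_inl _ hr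
  · cases p <;> rfl
  · cases q <;> rfl

theorem IsEdge.tensor_right (f : X ⟶ Y) {g : X' ⟶ Y'} (l : Occ X.formula → L)
    {k : Occ X'.formula → L} {P Q : L ⊕ Occ Y'.formula} (h : IsEdge k g P Q) :
    IsEdge (Sum.elim l k) (f ⊗ₘ g) (Sum.map id Sum.inr P) (Sum.map id Sum.inr Q) := by
  obtain ⟨p, q, hpq, hr, rfl, rfl⟩ := h
  refine ⟨Sum.map .inr .inr p, Sum.map .inr .inr q,
    (Sum.inr_injective.sumMap Sum.inr_injective).ne hpq, ?_, ?_, ?_⟩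
  · rw [diag_tensor]
    exact Diagram.tensor_rel_inr _ hr
  · cases p <;> rfl
  · cases q <;> rfl

/-- The points of the diagram of `g` in the diagram of `(f ⊗ g) ≫ t`, where `P` is the label of
the point joined to the right end of the bottom of `f`. -/
def transPoint (P : L) : L ⊕ Fin 2 → L ⊕ Fin 2
  | .inl Q => .inl Q
  | .inr 0 => .inl P
  | .inr 1 => .inr 1

theorem isEdge_trans_left {x y z : V} (f : X ⟶ atomic x y) (g : X' ⟶ atomic y z)
    (l : Occ X.formula → L) (k : Occ X'.formula → L) {p : Occ X.formula}
    (hp : (diag f).rel (.inl p) (.inr (0 : Fin 2))) :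
    IsEdge (Y := atomic x z) (Sum.elim l k) ((f ⊗ₘ g) ≫ transHom x y z) (.inr (0 : Fin 2))
      (.inl (l p)) := by
  refine ⟨.inr (0 : Fin 2), .inl (.inl p), Sum.inr_ne_inl, ?_, rfl, rfl⟩
  rw [diag_comp, diag_tensor]
  have h₁ := Diagram.eqvGen_lower (Diagram.tensor (diag f) (diag g)) (E := Diagram.trans)
    (a := .inr (0 : Fin 2)) (b := .inl (.inl (0 : Fin 2))) rfl
  have h₂ := Diagram.eqvGen_upper Diagram.trans
    (Diagram.tensor_rel_inl (diag g) ((diag f).rel.symm hp))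
  exact h₁.trans _ _ _ h₂

/-- Edges of `g` survive transitivity. Its right end stays at the bottom, while its left end is led
through the cup to the right end of `f` and up to `p`; `transPoint` records this replacement. -/
theorem IsEdge.trans_right {x y z : V} (f : X ⟶ atomic x y) {g : X' ⟶ atomic y z}
    (l : Occ X.formula → L) {k : Occ X'.formula → L} {p : Occ X.formula}
    (hp : (diag f).rel (.inl p) (.inr (1 : Fin 2))) {P Q : L ⊕ Fin 2}
    (h : IsEdge (Y := atomic y z) k g P Q) :
    IsEdge (Y := atomic x z) (Sum.elim l k) ((f ⊗ₘ g) ≫ transHom x y z)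
      (transPoint (l p) P) (transPoint (l p) Q) := by
  -- `φ` sends a point of the diagram of `g` to the outer point of the composite that it reaches.
  let φ : Occ X'.formula ⊕ Fin 2 → (Occ X.formula ⊕ Occ X'.formula) ⊕ Fin 2 :=
    Sum.elim (fun q => .inl (.inr q)) ![.inl (.inl p), .inr 1]
  have hφ : Function.Injective φ := by
    rintro (a | a) (b | b) <;> try fin_cases a
    all_goals try fin_cases b
    all_goals simp [φ]
  have hlink : ∀ q : Occ X'.formula ⊕ Fin 2,
      Relation.EqvGen (Diagram.Link (Diagram.tensor (diag f) (diag g)).rel Diagram.trans.rel)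
        (Sum.map id Sum.inr (φ q)) (Sum.map id Sum.inl (Sum.map Sum.inr Sum.inr q)) := by
    rintro (q | q)
    · exact .refl _
    · fin_cases q
      · have h₁ := Diagram.eqvGen_upper Diagram.trans (Diagram.tensor_rel_inl (diag g) hp)
        have h₂ := Diagram.eqvGen_lower (Diagram.tensor (diag f) (diag g)) (E := Diagram.trans)
          (a := .inl (.inl (1 : Fin 2))) (b := .inl (.inr (0 : Fin 2))) rfl
        exact h₁.trans _ _ _ h₂
      · exact Diagram.eqvGen_lower (Diagram.tensor (diag f) (diag g)) (E := Diagram.trans)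
          (a := .inr (1 : Fin 2)) (b := .inl (.inr (1 : Fin 2))) rfl
  have hmap : ∀ q : Occ X'.formula ⊕ Fin 2,
      Sum.map (Sum.elim l k) id (φ q) = transPoint (l p) (Sum.map k id q) := by
    rintro (q | q)
    · rfl
    · fin_cases q <;> rfl
  obtain ⟨q, q', hq, hr, rfl, rfl⟩ := h
  refine ⟨φ q, φ q', hφ.ne hq, ?_, hmap q, hmap q'⟩
  rw [diag_comp, diag_tensor]
  exact .trans _ _ _ (hlink q) (.trans _ _ _
    (Diagram.eqvGen_upper _ (Diagram.tensor_rel_inr (diag f) hr)) (.symm _ _ (hlink q')))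

end SEquiv

/-! ### The occurrences of variables in a set of atoms -/

/-- The side of an occurrence in an atom. -/
def atomLabel (x y : V) : (u : Bool) → Occ (atomObj atomic x y u).formula → Bool
  | true, i => (fun j : Fin 2 => decide (j = 1)) i
  | false, i => Fin.elim0 i

/-- The atom and the side of an occurrence in the product of a set of atoms. -/
def occLabel : (A : Formula V) → (U : Mask A) → Occ (partObj A U).formula → At A × Bool
  | .top, _, i => Fin.elim0 i
  | .eqv x y, U, i => ((), atomLabel x y (U ()) i)
  | .and A B, U, i => Sum.elim (fun i => Prod.map Sum.inl id (occLabel A U.fst i))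
      (fun i => Prod.map Sum.inr id (occLabel B U.snd i)) i

theorem atomLabel_injective (x y : V) (u : Bool) : Function.Injective (atomLabel x y u) := by
  cases u
  · exact fun i => Fin.elim0 i
  · change Function.Injective fun i : Fin 2 => decide (i = 1)
    decide

theorem occLabel_injective (A : Formula V) (U : Mask A) :
    Function.Injective (occLabel A U) := by
  induction A with
  | top => exact fun i => Fin.elim0 i
  | eqv x y =>
    exact fun i j h => atomLabel_injective x y _ (congrArg Prod.snd h)
  | and A B ihA ihB =>
    rintro (i | i) (j | j) h
    · exact congrArg _ (ihA _ ((Sum.inl_injective.prodMap Function.injective_id) h))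
    · exact absurd (congrArg Prod.fst h) Sum.inl_ne_inr
    · exact absurd (congrArg Prod.fst h) Sum.inr_ne_inl
    · exact congrArg _ (ihB _ ((Sum.inr_injective.prodMap Function.injective_id) h))

theorem follows_atomSplit (x y : V) (u s t : Bool) (h : u = (s || t) ∧ (s && t) = false) :
    Follows (atomSplit atomic x y u s t h) (atomLabel x y u)
      (Sum.elim (atomLabel x y s) (atomLabel x y t)) := by
  cases u <;> cases s <;> cases t <;> first
    | (exfalso; revert h; decide)
    | exact follows_leftUnitor_inv _ _
    | exact follows_rightUnitor_inv _ _

theorem follows_partSplit {A : Formula V} {U S T : Mask A} (h : Split U S T) :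
    Follows (partSplit h) (occLabel A U) (Sum.elim (occLabel A S) (occLabel A T)) := by
  induction A with
  | top => exact follows_leftUnitor_inv _ _
  | eqv x y =>
    refine ((follows_atomSplit x y _ _ _ (h ())).map fun e => ((), e)).congr ?_
    rintro (_ | _) <;> rfl
  | and A B ihA ihB =>
    have hA := (ihA h.inl).map (Prod.map (Sum.inl (β := At B)) (id : Bool → Bool))
    have hB := (ihB h.inr).map (Prod.map (Sum.inr (α := At A)) (id : Bool → Bool))
    refine Follows.comp (Follows.tensor ?_ ?_) (follows_tensorμ _ _ _ _)
    · refine Follows.congr hA ?_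
      rintro (_ | _) <;> rfl
    · refine Follows.congr hB ?_
      rintro (_ | _) <;> rfl

/-- The side of entry `e` appears at the left end of the bottom and the side of exit at the right
end, in both orientations. -/
theorem follows_orientAtom (x y : V) (u e : Bool) (h : u = true) :
    Follows (orientAtom x y u e h) (atomLabel x y u)
      (fun i : Fin 2 => if i = 0 then e else !e) := by
  subst h
  cases e
  · refine (follows_id (X := atomic x y) _).congr (X := atomic x y) (Y := atomic x y) ?_
    change ∀ i : Fin 2, decide (i = 1) = _
    decide
  · refine (follows_symmHom x y _).congr ?_
    change ∀ i : Fin 2, decide (Equiv.swap 0 1 i = 1) = _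
    decide

theorem follows_stepHom {A : Formula V} {U : Mask A} {a : At A} {e : Bool} (h : Single U a)
    {x y : V} (hx : endVar A a e = x) (hy : endVar A a (!e) = y) :
    Follows (stepHom h hx hy) (occLabel A U) (fun i : Fin 2 => (a, if i = 0 then e else !e)) := by
  induction A with
  | top => exact a.elim
  | eqv x' y' =>
    subst hx hy
    rw [stepHom, eqToHom_refl, Category.comp_id]
    exact (follows_orientAtom x' y' _ e _).map fun e => ((), e)
  | and A B ihA ihB =>
    rcases a with a | a
    · rw [stepHom_inl h hx hy]
      have hA := (ihA h.inl hx hy).map (Prod.map (Sum.inl (β := At B)) (id : Bool → Bool))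
      exact (((follows_id _).tensor (follows_unit _ _)).comp (follows_rightUnitor_hom _)).comp hA
    · rw [stepHom_inr h hx hy]
      have hB := (ihB h.inr hx hy).map (Prod.map (Sum.inr (α := At A)) (id : Bool → Bool))
      exact (((follows_unit _ _).tensor (follows_id _)).comp (follows_leftUnitor_hom _)).comp hB

/-! ### A diagram determines the walks of a normal form -/

/-- A path that starts at `P`, passes the elements of the list one after the other, each from
the given side to the other one, and ends at `out`. -/
def Traces {K O : Type} (R : (K × Bool) ⊕ O → (K × Bool) ⊕ O → Prop) (out : O) :
    (K × Bool) ⊕ O → List (K × Bool) → Prop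
  | P, [] => R P (.inr out)
  | P, (a, e) :: w => R P (.inl (a, e)) ∧ Traces R out (.inl (a, !e)) w

/-- Each next point is forced by `hR`, and the two summands tell whether the path goes on or has
ended. -/
theorem Traces.unique {K O : Type} {R : (K × Bool) ⊕ O → (K × Bool) ⊕ O → Prop}
    (hR : ∀ P Q Q', R P Q → R P Q' → Q = Q') {out : O} {P : (K × Bool) ⊕ O}
    {w w' : List (K × Bool)} (h : Traces R out P w) (h' : Traces R out P w') : w = w' := by
  induction w generalizing P w' with
  | nil =>
    cases w' with
    | nil => rfl
    | cons p' w' => exact absurd (hR _ _ _ h h'.1) Sum.inr_ne_inl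
  | cons p w ih =>
    cases w' with
    | nil => exact absurd (hR _ _ _ h.1 h') Sum.inl_ne_inr
    | cons p' w' =>
      obtain rfl : p = p' := Sum.inl_injective (hR _ _ _ h.1 h'.1)
      rw [ih h.2 h'.2]

theorem Traces.map {K O O' : Type} {R : (K × Bool) ⊕ O → (K × Bool) ⊕ O → Prop}
    {R' : (K × Bool) ⊕ O' → (K × Bool) ⊕ O' → Prop} (φ : (K × Bool) ⊕ O → (K × Bool) ⊕ O')
    (hR : ∀ P Q, R P Q → R' (φ P) (φ Q)) (hφ : ∀ P, φ (.inl P) = .inl P) {out : O} {out' : O'}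
    (hout : φ (.inr out) = .inr out') {P : (K × Bool) ⊕ O} {w : List (K × Bool)}
    (h : Traces R out P w) : Traces R' out' (φ P) w := by
  induction w generalizing P with
  | nil =>
    have := hR _ _ h
    rwa [hout] at this
  | cons p w ih =>
    have h1 := hR _ _ h.1
    have h2 := ih h.2
    rw [hφ] at h1 h2
    exact ⟨h1, h2⟩

/-- Reflexivity gives the cap that closes the path. In a longer walk the left end at the bottom
leads to side `e` of the first atom; its other side is connected by the cup to the start of the
remaining walk. -/
theorem IsWalk.traces {A : Formula V} {w : List (At A × Bool)} {U : Mask A} {x z : V}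
    {f : partObj A U ⟶ atomic x z} (hf : IsWalk A w U x z f) :
    Traces (IsEdge (Y := atomic x z) (occLabel A U) f) (1 : Fin 2) (.inr (0 : Fin 2)) w := by
  induction w generalizing U x with
  | nil =>
    obtain ⟨hU, rfl, rfl⟩ := hf
    refine ⟨.inr (0 : Fin 2), .inr (1 : Fin 2), ?_, ?_, rfl, rfl⟩
    · exact fun h => absurd (Sum.inr_injective h) (by decide : (0 : Fin 2) ≠ 1)
    · rw [diag_comp, reflHom_rfl]
      exact Diagram.eqvGen_lower (diag (partCounit hU)) (E := Diagram.cap) (a := .inr (0 : Fin 2))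
        (b := .inr (1 : Fin 2)) trivial
  | cons p w ih =>
    obtain ⟨a, e⟩ := p
    obtain ⟨S, T, h, hS, y, hx, hy, g, hg, rfl⟩ := hf
    obtain ⟨p₀, hp₀, e₀⟩ := follows_stepHom hS hx hy (0 : Fin 2)
    obtain ⟨p₁, hp₁, e₁⟩ := follows_stepHom hS hx hy (1 : Fin 2)
    change occLabel A S p₀ = (a, e) at e₀
    change occLabel A S p₁ = (a, !e) at e₁
    constructor
    · rw [← e₀]
      exact (isEdge_trans_left _ g _ _ hp₀).comp_left (follows_partSplit h)
    · rw [← e₁]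
      -- The remaining walk begins at the left end of `g`, which `transPoint` replaces by `(a, !e)`.
      exact (ih hg).map (transPoint (occLabel A S p₁))
        (fun P Q hPQ => (hPQ.trans_right _ _ hp₁).comp_left (follows_partSplit h))
        (fun _ => rfl) rfl

/-- The two occurrences of variables in an atom of a formula. -/
def atomOcc : (B : Formula V) → At B → Bool → Occ B
  | .eqv _ _, _, e => (bif e then 1 else 0 : Fin 2)
  | .and B _, .inl b, e => .inl (atomOcc B b e)
  | .and _ C, .inr c, e => .inr (atomOcc C c e)

theorem IsNormal.traces {A B : Formula V} {d : At B → List (At A × Bool)} {U : Mask A}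
    {f : partObj A U ⟶ (⟨B⟩ : SEquiv V)} (hf : IsNormal A B d U f) (b : At B) :
    Traces (IsEdge (occLabel A U) f) (atomOcc B b true) (.inr (atomOcc B b false)) (d b) := by
  induction B generalizing U with
  | top => exact b.elim
  | eqv x z => exact IsWalk.traces hf
  | and B C ihB ihC =>
    obtain ⟨S, T, h, f₁, f₂, h₁, h₂, rfl⟩ := hf
    rcases b with b | b
    · exact (ihB h₁ b).map (Sum.map id Sum.inl)
        (fun P Q hPQ => (hPQ.tensor_left _ _).comp_left (follows_partSplit h)) (fun _ => rfl) rfl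
    · exact (ihC h₂ b).map (Sum.map id Sum.inr)
        (fun P Q hPQ => (hPQ.tensor_right _ _).comp_left (follows_partSplit h)) (fun _ => rfl) rfl

/-- Normal forms with the same diagram are equal. -/
theorem IsNormal.eq_of_diag_eq {A B : Formula V} {d d' : At B → List (At A × Bool)} {U : Mask A}
    {f f' : partObj A U ⟶ (⟨B⟩ : SEquiv V)} (hf : IsNormal A B d U f)
    (hf' : IsNormal A B d' U f') (h : diag f = diag f') : f = f' := by
  obtain rfl : d = d' := funext fun b => by
    -- `IsEdge` involves the arrow only through its diagram.
    have e : IsEdge (occLabel A U) f = IsEdge (occLabel A U) f' := by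
      unfold IsEdge
      rw [h]
    have h₁ := hf.traces b
    have h₂ := hf'.traces b
    rw [← e] at h₂
    exact Traces.unique (R := IsEdge (Y := ⟨B⟩) (occLabel A U) f)
      (fun _ _ _ => IsEdge.right_unique (occLabel_injective A U)) h₁ h₂
  exact hf.unique hf'

/-! ### Faithfulness. -/

/-- Both arrows are precomposed with the normal isomorphism onto the source. The composites are
normal with equal diagrams, hence equal, and the isomorphism cancels. -/
theorem SEquiv.eq_of_diag_eq {X Y : SEquiv V} {f g : X ⟶ Y} (h : diag f = diag g) : f = g := by
  rcases f with ⟨f⟩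
  rcases g with ⟨g⟩
  obtain ⟨d, hd⟩ := exists_isNormal_fullIso X.formula (fun _ => true) fun _ => rfl
  obtain ⟨d₁, h₁⟩ := hd.exists_comp f
  obtain ⟨d₂, h₂⟩ := hd.exists_comp g
  have e := h₁.eq_of_diag_eq h₂ (by
    rw [diag_comp, diag_comp]
    exact congrArg _ h)
  exact (cancel_epi _).1 e

/-- `G` numbers the occurrences by ordinals, whereas the argument works with the occurrences
themselves; renumbering loses nothing. -/
theorem Diagram.reindex_injective {X Y X' Y' : Type} (e : X ≃ X') (e' : Y ≃ Y') :
    Function.Injective (Diagram.reindex e e') := by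
  intro D E h
  apply Diagram.eq_of_le
  intro a b hab
  have key : ∀ F : Diagram X Y, (Diagram.reindex e e' F).rel (Equiv.sumCongr e e' a)
      (Equiv.sumCongr e e' b) ↔ F.rel a b := fun F => by
    rw [Diagram.reindex, Setoid.comap_rel, Equiv.symm_apply_apply, Equiv.symm_apply_apply]
  rw [← key, ← h, key]
  exact hab

end

theorem mainTheorem4 (V : Type u) : (SEquiv.G V).Faithful := by
  constructor
  rintro X Y ⟨f⟩ ⟨g⟩ h
  -- By definition of `G`, `h` is an equality of reindexed diagrams.
  exact SEquiv.eq_of_diag_eq (Diagram.reindex_injective _ _ h)
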